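/- A system on a finite set $V$ is a family $\mathcal C\subseteq 2^V$, whose members are called components; it is transitive if $X,Y,Z\in\mathcal C$ and $Z\subseteq X\cap Y$ imply $X\cup Y\in\mathcal C$. For $Y\subseteq V$ let $\mathcal C_{\max}(Y)$ be the family of the inclusion-wise maximal components contained in $Y$. Let $\rho:2^V\to\mathbb R$ be a volume function, that is, $\rho(X)\le\rho(Y)$ for $X\subseteq Y\subseteq V$; a set $X$ is $\rho$-positive if $\rho(X)>0$. Let $\delta:2^V\to\mathbb N$ be non-decreasing with respect to inclusion, with $|\mathcal C_{\max}(X)|\le\delta(X)$ for all $X\subseteq V$. Suppose that $\mathcal C$ is given by two oracles: for $\emptyset\neq X\subseteq Y\subseteq V$, $\mathrm L_1(X,Y)$ returns a set $Z\in\mathcal C_{\max}(Y)$ with $X\subseteq Z$ (or $\emptyset$ if there is none) in $\theta_{1,t}$ time and $\theta_{1,s}$ space; for $\emptyset\ne Y\subseteq V$, $\mathrm L_2(Y)$ returns $\mathcal C_{\max}(Y)$ in $\theta_{2,t}\geq 1$ time and $\theta_{2,s}$ space. Suppose that whether $\rho(X)>0$ can be tested in $\theta_{\rho,t}$ time and $\theta_{\rho,s}$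 space. Let $(V,\mathcal C)$ be a transitive system with $V=\{v_1,\dots,v_n\}$, $n=|V|\ge 1$. (a) Let $I=[1,n]$ and $\varphi(v_k)=I\setminus\{k\}$, and for $X\subseteq V$ let $I_\varphi(X)=\bigcap_{v\in X}\varphi(v)$, with $I_\varphi(\emptyset)=I$. Then $\mathcal C$ is equal to the family of all solutions of the instance $(V,\mathcal C,I,\varphi)$, that is, of all $X\in\mathcal C$ such that $I_\varphi(Y)\subsetneq I_\varphi(X)$ for every $Y\in\mathcal C$ with $Y\supsetneq X$. (b) There is one algorithm (for a random access machine with access to $\mathrm L_1$, $\mathrm L_2$ and the test for $\rho$-positivity) that, for all such systems in which $\emptyset$ is not a $\rho$-positive component, outputs every $\rho$-positive component exactly once and nothing else, and then halts, with delay $$O\big(n\theta_{2,t}+(n^2+n\theta_{1,t}+\theta_{\rho,t})\,n\,\delta(V)\big)$$ and in space $$O\big((n+\theta_{1,s}+\theta_{2,s}+\theta_{\rho,s})\,n\big).$$ Here the delay bounds the time before the first output, the time between any two consecutive outputs, and the time from the last output to the halt, and the constants in $O(\cdot)$ are absolute. -/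

import Mathlib

universe u w

/-! ## Transitive systems, instances and solutions -/

/-- Any components `X, Y, Z` with `Z ⊆ X ∩ Y` satisfy `X ∪ Y ∈ C`. -/
def IsTransitive {V : Type u} (C : Set (Set V)) : Prop :=
  ∀ X ∈ C, ∀ Y ∈ C, ∀ Z ∈ C, Z ⊆ X ∩ Y → X ∪ Y ∈ C

/-- The family of all `Y`-maximal components. -/
def maxComponents {V : Type u} (C : Set (Set V)) (Y : Set V) : Set (Set V) :=
  {Z | Z ∈ C ∧ Z ⊆ Y ∧ ∀ W ∈ C, W ⊆ Y → ¬ Z ⊂ W}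

/-- The family of all `Y`-maximal components that contain `X`. -/
def maxComponentsOver {V : Type u} (C : Set (Set V)) (X Y : Set V) : Set (Set V) :=
  {Z | Z ∈ maxComponents C Y ∧ X ⊆ Z}

/-- The common item set of `X` (for empty `X` it is the set `I` of all items). -/
def commonItems {V : Type u} {ι : Type w} (I : Set ι) (σ : V → Set ι) (X : Set V) : Set ι :=
  {i | i ∈ I ∧ ∀ x ∈ X, i ∈ σ x}

/-- `X` is a solution of the instance `(V, C, I, σ)`. -/
def IsSolution {V : Type u} {ι : Type w} (C : Set (Set V)) (I : Set ι) (σ : V → Set ι)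
    (X : Set V) : Prop :=
  X ∈ C ∧ ∀ Y ∈ C, X ⊂ Y → commonItems I σ Y ⊂ commonItems I σ X

/-- `φ(v_k) = [1,n] \ {k}`, where `v_k` is `v (k - 1)` since `Fin n` counts from `0`. -/
def coItems {V : Type u} {n : ℕ} (v : Fin n ≃ V) (x : V) : Set ℕ :=
  Set.Icc 1 n \ {((v.symm x : Fin n) : ℕ) + 1}

/-- Contract of the first oracle. Nothing is promised outside `∅ ≠ X ⊆ Y`. -/
def IsFirstOracle {V : Type u} (C : Set (Set V)) (L₁ : Set V → Set V → Set V) : Prop :=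
  ∀ X Y : Set V, X.Nonempty → X ⊆ Y →
    L₁ X Y ∈ maxComponentsOver C X Y ∨ (maxComponentsOver C X Y = ∅ ∧ L₁ X Y = ∅)

/-- Contract of the second oracle: it lists all `Y`-maximal components, in any order and
without repetition. Nothing is promised for empty `Y`. -/
def IsSecondOracle {V : Type u} (C : Set (Set V)) (L₂ : Set V → List (Set V)) : Prop :=
  ∀ Y : Set V, Y.Nonempty → (L₂ Y).Nodup ∧ ∀ Z, Z ∈ L₂ Y ↔ Z ∈ maxComponents C Y

/-! ## A random access machine with oracles -/

/-- Expressions over the memory. `load e` is the content of the cell with address `e`. -/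
inductive Expr : Type
  | const (k : ℕ)
  | load (e : Expr)
  | plus (e₁ e₂ : Expr)
  | minus (e₁ e₂ : Expr)

/-- Value of an expression (subtraction is truncated at `0`). -/
def Expr.eval (m : ℕ → ℕ) : Expr → ℕ
  | .const k => k
  | .load e => m (e.eval m)
  | .plus e₁ e₂ => e₁.eval m + e₂.eval m
  | .minus e₁ e₂ => e₁.eval m - e₂.eval m

/-- Number of elementary operations in an expression: the time to evaluate it. -/
def Expr.size : Expr → ℕ
  | .const _ => 1
  | .load e => e.size + 1
  | .plus e₁ e₂ => e₁.size + e₂.size + 1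
  | .minus e₁ e₂ => e₁.size + e₂.size + 1

/-- Programs. A subset of `V = {v_1, …, v_n}` is passed as the address of `n` consecutive cells
that hold its characteristic vector. A condition holds if the value is nonzero. -/
inductive Cmd : Type
  /-- `store a e`: write the value of `e` into cell `a` -/
  | store (a e : Expr)
  | seq (P Q : Cmd)
  | cond (e : Expr) (P Q : Cmd)
  | loop (e : Expr) (P : Cmd)
  /-- `first x y z`: write `L₁(X, Y)` to address `z`, where `X`, `Y` are the sets at `x`, `y` -/
  | first (x y z : Expr)
  /-- `second y`: call `L₂(Y)` for the set `Y` at `y`; the answer is then read with `next` -/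
  | second (y : Expr)
  /-- `next z f`: take the next component of the most recent answer of `L₂` that is still open,
  write it to address `z` and `1` to cell `f`; if all its components have been taken (or no
  answer is open), close it and write `0` to cell `f` -/
  | next (z f : Expr)
  /-- `volume x f`: write to cell `f` whether the set at `x` is `ρ`-positive (`1` or `0`) -/
  | volume (x f : Expr)
  /-- `output x`: output the set at `x` -/
  | output (x : Expr)

/-- What a program is run on: the numbering of `V`, the oracles, the volume function, and the
time and space that one call of the first oracle, of the second oracle and of the test for
`ρ`-positivity takes. -/
structure Env (V : Type u) (n : ℕ) where
  v : Fin n ≃ V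
  L₁ : Set V → Set V → Set V
  L₂ : Set V → List (Set V)
  ρ : Set V → ℝ
  θ₁t : ℕ
  θ₁s : ℕ
  θ₂t : ℕ
  θ₂s : ℕ
  θρt : ℕ
  θρs : ℕ

/-- A configuration of the machine, together with the resources used so far. -/
structure Config (V : Type u) where
  /-- the memory -/
  mem : ℕ → ℕ
  /-- for each open answer of `L₂`, most recent first, the components not yet taken -/
  pending : List (List (Set V))
  /-- time elapsed -/
  time : ℕ
  /-- the outputs so far in chronological order, each with the time of its completion -/
  outs : List (ℕ × Set V)
  /-- largest address written to and largest value written so far: the memory in use consists of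
  the cells `0, …, top`, each with a content of at most `top`. -/
  top : ℕ
  /-- largest space so far taken at one time by oracles and open answers of `L₂` -/
  aux : ℕ

namespace Config

variable {V : Type u} {n : ℕ}

/-- Let time pass. -/
def tick (s : Config V) (k : ℕ) : Config V := { s with time := s.time + k }

/-- Write the value `x` into cell `a`. -/
def write (s : Config V) (a x : ℕ) : Config V :=
  { s with mem := Function.update s.mem a x, top := max s.top (max a x) }

/-- The subset of `V` whose characteristic vector is stored at address `a`. -/
def setAt (s : Config V) (v : Fin n ≃ V) (a : ℕ) : Set V :=
  {x | s.mem (a + (v.symm x : Fin n)) ≠ 0}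

open Classical in
/-- Write the characteristic vector of `X` to the cells `a, …, a + n - 1`. -/
noncomputable def writeSet (s : Config V) (v : Fin n ≃ V) (a : ℕ) (X : Set V) : Config V :=
  { s with
    mem := fun b => if h : a ≤ b ∧ b < a + n then
        (if v ⟨b - a, by omega⟩ ∈ X then 1 else 0) else s.mem b
    top := max s.top (a + n) }

/-- Space taken by the open answers of `L₂`, if an answer occupies `k` cells besides a
reference to it. -/
def answerSpace (s : Config V) (k : ℕ) : ℕ := s.pending.length * (k + 1)

/-- Register that oracles and open answers take the space `k` at one time. -/
def useAux (s : Config V) (k : ℕ) : Config V := { s with aux := max s.aux k }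

/-- Start: cell `0` holds `n`, all other cells hold `0`. -/
def init (V : Type u) (n : ℕ) : Config V where
  mem := fun a => if a = 0 then n else 0
  pending := []
  time := 0
  outs := []
  top := n
  aux := 0

end Config

/-- `Exec E P s s'`: started in `s`, the program `P` halts, in `s'`. Every elementary operation
takes one time unit; passing a set to or from an oracle or to the output takes another `n` time
units, in addition to the time of the oracle. The space `θ₂s` of a call of `L₂` stays occupied
as long as its answer is open. -/
inductive Exec {V : Type u} {n : ℕ} (E : Env V n) : Cmd → Config V → Config V → Prop
  | store (a e : Expr) (s : Config V) :
      Exec E (.store a e) s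
        ((s.write (a.eval s.mem) (e.eval s.mem)).tick (a.size + e.size + 1))
  | seq (P Q : Cmd) (s s' s'' : Config V) :
      Exec E P s s' → Exec E Q s' s'' → Exec E (.seq P Q) s s''
  | cond_true (e : Expr) (P Q : Cmd) (s s' : Config V) :
      e.eval s.mem ≠ 0 → Exec E P (s.tick (e.size + 1)) s' → Exec E (.cond e P Q) s s'
  | cond_false (e : Expr) (P Q : Cmd) (s s' : Config V) :
      e.eval s.mem = 0 → Exec E Q (s.tick (e.size + 1)) s' → Exec E (.cond e P Q) s s'
  | loop_true (e : Expr) (P : Cmd) (s s' s'' : Config V) :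
      e.eval s.mem ≠ 0 → Exec E P (s.tick (e.size + 1)) s' → Exec E (.loop e P) s' s'' →
      Exec E (.loop e P) s s''
  | loop_false (e : Expr) (P : Cmd) (s : Config V) :
      e.eval s.mem = 0 → Exec E (.loop e P) s (s.tick (e.size + 1))
  | first (x y z : Expr) (s : Config V) :
      Exec E (.first x y z) s
        (((s.writeSet E.v (z.eval s.mem)
              (E.L₁ (s.setAt E.v (x.eval s.mem)) (s.setAt E.v (y.eval s.mem)))).useAux
            (s.answerSpace E.θ₂s + E.θ₁s)).tick
          (x.size + y.size + z.size + 1 + n + E.θ₁t))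
  | second (y : Expr) (s : Config V) :
      Exec E (.second y) s
        (({ s with pending := E.L₂ (s.setAt E.v (y.eval s.mem)) :: s.pending }.useAux
            (s.answerSpace E.θ₂s + (E.θ₂s + 1))).tick
          (y.size + 1 + n + E.θ₂t))
  | next_some (z f : Expr) (s : Config V) (X : Set V) (l : List (Set V))
      (r : List (List (Set V))) :
      s.pending = (X :: l) :: r →
      Exec E (.next z f) s
        ((({ s with pending := l :: r }.writeSet E.v (z.eval s.mem) X).write
            (f.eval s.mem) 1).tick
          (z.size + f.size + 1 + n))
  | next_close (z f : Expr) (s : Config V) (r : List (List (Set V))) :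
      s.pending = [] :: r →
      Exec E (.next z f) s
        (({ s with pending := r }.write (f.eval s.mem) 0).tick (z.size + f.size + 1 + n))
  | next_none (z f : Expr) (s : Config V) :
      s.pending = [] →
      Exec E (.next z f) s ((s.write (f.eval s.mem) 0).tick (z.size + f.size + 1 + n))
  | volume_pos (x f : Expr) (s : Config V) :
      0 < E.ρ (s.setAt E.v (x.eval s.mem)) →
      Exec E (.volume x f) s
        (((s.write (f.eval s.mem) 1).useAux (s.answerSpace E.θ₂s + E.θρs)).tick
          (x.size + f.size + 1 + n + E.θρt))
  | volume_nonpos (x f : Expr) (s : Config V) :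
      E.ρ (s.setAt E.v (x.eval s.mem)) ≤ 0 →
      Exec E (.volume x f) s
        (((s.write (f.eval s.mem) 0).useAux (s.answerSpace E.θ₂s + E.θρs)).tick
          (x.size + f.size + 1 + n + E.θρt))
  | output (x : Expr) (s : Config V) :
      Exec E (.output x) s
        { s with
          time := s.time + (x.size + 1 + n)
          outs := s.outs ++ [(s.time + (x.size + 1 + n), s.setAt E.v (x.eval s.mem))] }

/-- On `E` the program `P` halts after having output every member of `F` exactly once and nothing
else; the time before the first output, between two consecutive outputs, and from the last output
to the halt is at most `D` each, and the run takes space at most `S`: at most `S` memory cells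
with contents at most `S`, together with the space of the oracles. -/
def Enumerates {V : Type u} {n : ℕ} (P : Cmd) (E : Env V n) (F : Set (Set V)) (D S : ℕ) : Prop :=
  ∃ s : Config V, Exec E P (Config.init V n) s ∧
    (s.outs.map Prod.snd).Nodup ∧
    (∀ X, X ∈ s.outs.map Prod.snd ↔ X ∈ F) ∧
    List.IsChain (fun t t' => t' ≤ t + D) (0 :: s.outs.map Prod.fst ++ [s.time]) ∧
    s.top + 1 + s.aux ≤ S

/-!
Every component is a solution because the item `k` belongs to `φ(v)` for all `v` except `v_k`:
adding `v_k` to a set removes `k` from the common items.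

The algorithm is a reverse search. A component `T` that is not maximal gets a `parent`, a minimal
component strictly above it: delete `v_n, …, v_1` in turn from `V`, keeping the elements of `T` and
those without which `T` would be maximal in the rest, as the first oracle tells (`parent_spec`). The
last element that was kept in this way gives the `key` of `T`. Since the parent `S` is minimal, `T`
is a maximal component of `S` without the element at the key, so that the second oracle, asked about
`S` without each of its elements, finds every child of `S`; it is accepted only at its own key, hence
once (`isChild_iff`). The roots of the family tree are the maximal components. All ancestors of a
`ρ`-positive component are `ρ`-positive (`exists_mem_descendants_iff`), so the search may skip
everything else. The parent is determined by which sets `T` is maximal in, and any answer of the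
first oracle decides that.

The machine keeps only the current node, its depth and the current index, since the node and the
index to return to are the parent and the key of the node that is left. The one stack is that of the
open answers of the second oracle, whose height is at most `n + 1` because components shrink along a
branch. A node is output when it is entered if its depth is odd, and when it is left if its depth is
even. Hence at most one node without an output is entered or left between two outputs, and the delay
is at most twice the time `W` that is spent at one node (`reach_scan`, `reach_indices`, `visits`).
That time consists of at most `n` questions to the second oracle and of at most `n * δ(V)`
candidates, each of which costs one computation of a parent, that is `n` questions to the first
oracle, and a test for `ρ`-positivity.

Programs are analysed through the relation `Run` between abstract states, in which the time since
the last output is bounded and outputs are allowed only within the delay; `Reach` is the analogue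
for rounds of the main loop. The numerical constants in the time bounds are generous.
-/

/-! ### Abstract machine states -/

/-- What a program knows about the memory: sixteen registers (the cells `0, …, 15`, the first of
which holds `n`) and six subsets of `V` (the `k`-th is stored from the cell `16 + k * n` on),
together with the open answers of `L₂` and the sets that were output. -/
structure AState (V : Type u) where
  reg : ℕ → ℕ
  arr : ℕ → Set V
  pend : List (List (Set V))
  outs : List (Set V)

namespace AState

variable {V : Type u}

/-- Write `x` to register `k`. -/
def setReg (st : AState V) (k x : ℕ) : AState V := { st with reg := Function.update st.reg k x }

/-- Replace the `k`-th set by `X`. -/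
def setArr (st : AState V) (k : ℕ) (X : Set V) : AState V :=
  { st with arr := Function.update st.arr k X }

@[simp] theorem setReg_reg (st : AState V) (k x l : ℕ) :
    (st.setReg k x).reg l = if l = k then x else st.reg l := by
  simp [setReg, Function.update_apply]

@[simp] theorem setReg_arr (st : AState V) (k x : ℕ) : (st.setReg k x).arr = st.arr := rfl
@[simp] theorem setReg_pend (st : AState V) (k x : ℕ) : (st.setReg k x).pend = st.pend := rfl
@[simp] theorem setReg_outs (st : AState V) (k x : ℕ) : (st.setReg k x).outs = st.outs := rfl

@[simp] theorem setArr_arr (st : AState V) (k : ℕ) (X : Set V) (l : ℕ) :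
    (st.setArr k X).arr l = if l = k then X else st.arr l := by
  simp [setArr, Function.update_apply]

@[simp] theorem setArr_reg (st : AState V) (k : ℕ) (X : Set V) :
    (st.setArr k X).reg = st.reg := rfl
@[simp] theorem setArr_pend (st : AState V) (k : ℕ) (X : Set V) :
    (st.setArr k X).pend = st.pend := rfl
@[simp] theorem setArr_outs (st : AState V) (k : ℕ) (X : Set V) :
    (st.setArr k X).outs = st.outs := rfl

open Classical in
/-- The memory `m` represents the registers and sets of `st`. -/
structure Models {n : ℕ} (v : Fin n ≃ V) (st : AState V) (m : ℕ → ℕ) : Prop where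
  size : st.reg 0 = n
  reg : ∀ k < 16, m k = st.reg k
  arr : ∀ k < 6, ∀ j : Fin n, m (16 + k * n + j) = if v j ∈ st.arr k then 1 else 0

end AState

/-- The expression for the address of the `k`-th set. -/
def arrayAddr : ℕ → Expr
  | 0 => .const 16
  | k + 1 => .plus (arrayAddr k) (.load (.const 0))

theorem array_disjoint {n k l i j : ℕ} (hi : i < n) (hj : j < n) :
    16 + k * n + i = 16 + l * n + j ↔ k = l ∧ i = j := by
  constructor
  · intro h
    have h' : k * n + i = l * n + j := by omega
    have hk : (k * n + i) / n = k := by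
      rw [mul_comm, Nat.mul_add_div (by omega), Nat.div_eq_of_lt hi, add_zero]
    have hl : (l * n + j) / n = l := by
      rw [mul_comm, Nat.mul_add_div (by omega), Nat.div_eq_of_lt hj, add_zero]
    have : k = l := by rw [← hk, h', hl]
    subst this
    exact ⟨rfl, by omega⟩
  · rintro ⟨rfl, rfl⟩
    rfl

theorem array_end_le {n k : ℕ} (hk : k < 6) : 16 + k * n + n ≤ 16 + 6 * n := by
  have : (k + 1) * n ≤ 6 * n := Nat.mul_le_mul_right n hk
  linarith [this, add_mul k 1 n]

namespace AState.Models

variable {V : Type u} {n : ℕ} {v : Fin n ≃ V} {st : AState V} {m : ℕ → ℕ}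

theorem eval_addr (h : st.Models v m) (k : ℕ) : (arrayAddr k).eval m = 16 + k * n := by
  induction k with
  | zero => simp [arrayAddr, Expr.eval]
  | succ k ih =>
    simp only [arrayAddr, Expr.eval, ih]
    rw [h.reg 0 (by norm_num), h.size]
    ring

theorem setAt_eq (h : st.Models v m) {k : ℕ} (hk : k < 6) (s : Config V) (hs : s.mem = m) :
    s.setAt v (16 + k * n) = st.arr k := by
  ext x
  obtain ⟨j, rfl⟩ := v.surjective x
  simp [Config.setAt, hs, h.arr k hk j]

theorem update_reg (h : st.Models v m) {k : ℕ} (hk : 0 < k) (hk' : k < 16) (x : ℕ) :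
    (st.setReg k x).Models v (Function.update m k x) where
  size := by simpa [hk.ne] using h.size
  reg l hl := by simp [Function.update_apply, h.reg l hl]
  arr l hl j := by
    rw [Function.update_of_ne (by omega), h.arr l hl j]
    rfl

open Classical in
theorem update_arr (h : st.Models v m) {k : ℕ} (j : Fin n) {p : Prop} {x : ℕ}
    (hx : x = if p then 1 else 0) :
    (st.setArr k {u | if u = v j then p else u ∈ st.arr k}).Models v
      (Function.update m (16 + k * n + j) x) where
  size := h.size
  reg l hl := by
    rw [Function.update_of_ne (by omega), h.reg l hl]
    rfl
  arr l hl i := by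
    rw [Function.update_apply, hx, h.arr l hl i]
    simp only [array_disjoint i.2 j.2]
    by_cases hlk : l = k
    · subst hlk
      by_cases hij : i = j
      · subst hij; simp
      · have : ¬ (i : ℕ) = j := fun h => hij (Fin.ext h)
        simp [hij, this]
    · simp [hlk]

open Classical in
theorem write_set (h : st.Models v m) {k : ℕ} (X : Set V) (s : Config V) (hs : s.mem = m) :
    (st.setArr k X).Models v (s.writeSet v (16 + k * n) X).mem where
  size := h.size
  reg l hl := by
    have : ¬ (16 + k * n ≤ l ∧ l < 16 + k * n + n) := by omega
    simp [Config.writeSet, this, hs, h.reg l hl]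
  arr l hl i := by
    have hi := i.2
    by_cases hlk : l = k
    · subst hlk
      simp [Config.writeSet]
    · have : ¬ (16 + k * n ≤ 16 + l * n + (i : ℕ) ∧ 16 + l * n + (i : ℕ) < 16 + k * n + n) := by
        rintro ⟨h1, h2⟩
        have := (array_disjoint (n := n) (k := l) (l := k) (i := i)
          (j := 16 + l * n + i - (16 + k * n)) hi (by omega)).1 (by omega)
        exact hlk this.1
      simp only [Config.writeSet, this, dif_neg, not_false_eq_true, hs, h.arr l hl i]
      simp [hlk]

end AState.Models

/-! ### Runs between abstract states -/

section Runs

variable {V : Type u} {n : ℕ}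

/-- The configuration `s` is described by `st`, its last output (or the start) lies at most `a`
time units back, all earlier delays are at most `D`, and the space bounds are kept. -/
structure Describes (E : Env V n) (D : ℕ) (st : AState V) (a : ℕ) (s : Config V) : Prop where
  mem : st.Models E.v s.mem
  pend : s.pending = st.pend
  outs : s.outs.map Prod.snd = st.outs
  chain : List.IsChain (fun t t' => t' ≤ t + D) (0 :: s.outs.map Prod.fst)
  time : ∀ t ∈ (0 :: s.outs.map Prod.fst).getLast?, s.time ≤ t + a
  top : s.top ≤ 16 + 6 * n
  aux : s.aux ≤ (n + 1) * (E.θ₂s + 1) + E.θ₁s + E.θρs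
  depth : st.pend.length ≤ n + 1

/-- The program `c` leads from `st` to `st'`, and the time since the last output is at most `a`
before and at most `b` after it. -/
def Run (E : Env V n) (D : ℕ) (c : Cmd) (st : AState V) (a : ℕ) (st' : AState V) (b : ℕ) : Prop :=
  ∀ s, Describes E D st a s → ∃ s', Exec E c s s' ∧ Describes E D st' b s'

variable {E : Env V n} {D : ℕ} {st st' st'' : AState V} {a b d : ℕ} {P Q : Cmd}

theorem Describes.mono {s : Config V} (h : Describes E D st a s) (hab : a ≤ b) :
    Describes E D st b s :=
  { h with time := fun t ht => (h.time t ht).trans (by omega) }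

theorem Describes.tick {s : Config V} (h : Describes E D st a s) (k : ℕ) :
    Describes E D st (a + k) (s.tick k) :=
  { h with time := fun t ht => by have := h.time t ht; simp only [Config.tick]; omega }

theorem Run.mono (h : Run E D P st a st' b) (hb : b ≤ d) : Run E D P st a st' d := fun s hs =>
  let ⟨s', h1, h2⟩ := h s hs
  ⟨s', h1, h2.mono hb⟩

theorem Run.seq (h₁ : Run E D P st a st' b) (h₂ : Run E D Q st' b st'' d) :
    Run E D (.seq P Q) st a st'' d := fun s hs =>
  let ⟨s', h1, h2⟩ := h₁ s hs
  let ⟨s'', h3, h4⟩ := h₂ s' h2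
  ⟨s'', .seq _ _ _ _ _ h1 h3, h4⟩

theorem Run.cond_true {e : Expr} (he : ∀ m, st.Models E.v m → e.eval m ≠ 0)
    (h : Run E D P st (a + (e.size + 1)) st' b) : Run E D (.cond e P Q) st a st' b := fun _ hs =>
  let ⟨s', h1, h2⟩ := h _ (hs.tick _)
  ⟨s', .cond_true _ _ _ _ _ (he _ hs.mem) h1, h2⟩

theorem Run.cond_false {e : Expr} (he : ∀ m, st.Models E.v m → e.eval m = 0)
    (h : Run E D Q st (a + (e.size + 1)) st' b) : Run E D (.cond e P Q) st a st' b := fun _ hs =>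
  let ⟨s', h1, h2⟩ := h _ (hs.tick _)
  ⟨s', .cond_false _ _ _ _ _ (he _ hs.mem) h1, h2⟩

theorem Run.loop_true {e : Expr} (he : ∀ m, st.Models E.v m → e.eval m ≠ 0)
    (h : Run E D P st (a + (e.size + 1)) st' b) (h' : Run E D (.loop e P) st' b st'' d) :
    Run E D (.loop e P) st a st'' d := fun _ hs =>
  let ⟨_, h1, h2⟩ := h _ (hs.tick _)
  let ⟨s'', h3, h4⟩ := h' _ h2
  ⟨s'', .loop_true _ _ _ _ _ (he _ hs.mem) h1 h3, h4⟩

theorem Run.loop_false {e : Expr} (he : ∀ m, st.Models E.v m → e.eval m = 0) :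
    Run E D (.loop e P) st a st (a + (e.size + 1)) := fun _ hs =>
  ⟨_, .loop_false _ _ _ (he _ hs.mem), hs.tick _⟩

theorem Run.store_reg {k x : ℕ} {e : Expr} (hk : 0 < k) (hk' : k < 16)
    (he : ∀ m, st.Models E.v m → e.eval m = x) (hx : x ≤ 16 + 6 * n) :
    Run E D (.store (.const k) e) st a (st.setReg k x) (a + (e.size + 2)) := fun s hs => by
  refine ⟨_, .store _ _ _, ?_⟩
  refine Describes.mono (Describes.tick (a := a) ?_ _)
    (by simp only [Expr.size]; omega)
  rw [he _ hs.mem]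
  exact { hs with
    mem := hs.mem.update_reg hk hk' x
    top := by have := hs.top; simp only [Config.write, Expr.eval]; omega }

open Classical in
theorem Run.store_arr {k l x : ℕ} {e : Expr} {p : Prop} (j : Fin n) (hk : k < 6) (hl : l < 16)
    (hj : st.reg l = j) (he : ∀ m, st.Models E.v m → e.eval m = x)
    (hx : x = if p then 1 else 0) :
    Run E D (.store (.plus (arrayAddr k) (.load (.const l))) e) st a
      (st.setArr k {u | if u = E.v j then p else u ∈ st.arr k})
      (a + ((arrayAddr k).size + e.size + 4)) := fun s hs => by
  refine ⟨_, .store _ _ _, ?_⟩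
  refine Describes.mono (Describes.tick (a := a) ?_ _)
    (by simp only [Expr.size]; omega)
  have hx1 : x ≤ 1 := by rw [hx]; split <;> simp
  have := array_end_le (n := n) hk
  rw [he _ hs.mem]
  simp only [Expr.eval, hs.mem.eval_addr, hs.mem.reg l hl, hj]
  exact { hs with
    mem := hs.mem.update_arr j hx
    top := by have := hs.top; have := j.2; simp only [Config.write]; omega }

theorem Describes.answerSpace_le {s : Config V} (hs : Describes E D st a s) :
    s.answerSpace E.θ₂s ≤ (n + 1) * (E.θ₂s + 1) := by
  unfold Config.answerSpace
  rw [hs.pend]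
  exact Nat.mul_le_mul_right _ hs.depth

theorem Run.first {x y z : ℕ} (hx : x < 6) (hy : y < 6) (hz : z < 6) :
    Run E D (.first (arrayAddr x) (arrayAddr y) (arrayAddr z)) st a
      (st.setArr z (E.L₁ (st.arr x) (st.arr y)))
      (a + ((arrayAddr x).size + (arrayAddr y).size + (arrayAddr z).size + 1 + n + E.θ₁t)) :=
    fun s hs => by
  refine ⟨_, .first _ _ _ _, Describes.tick ?_ _⟩
  have := array_end_le (n := n) hz
  have h1 := hs.top
  have h2 := hs.aux
  have h3 := hs.answerSpace_le
  rw [hs.mem.eval_addr, hs.mem.eval_addr, hs.mem.eval_addr, hs.mem.setAt_eq hx s rfl,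
    hs.mem.setAt_eq hy s rfl]
  exact { hs with
    mem := hs.mem.write_set _ s rfl
    top := by simp only [Config.useAux, Config.writeSet]; omega
    aux := by
      simp only [Config.useAux, Config.answerSpace, Config.writeSet] at h3 ⊢
      omega }

theorem Run.second {y : ℕ} (hy : y < 6) (hd : st.pend.length ≤ n) :
    Run E D (.second (arrayAddr y)) st a { st with pend := E.L₂ (st.arr y) :: st.pend }
      (a + ((arrayAddr y).size + 1 + n + E.θ₂t)) := fun s hs => by
  refine ⟨_, .second _ _, Describes.tick ?_ _⟩
  have h2 := hs.aux
  have h3 : st.pend.length * (E.θ₂s + 1) ≤ n * (E.θ₂s + 1) := Nat.mul_le_mul_right _ hd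
  have h4 : (n + 1) * (E.θ₂s + 1) = n * (E.θ₂s + 1) + (E.θ₂s + 1) := by ring
  rw [hs.mem.eval_addr, hs.mem.setAt_eq hy s rfl]
  exact { hs with
    mem := ⟨hs.mem.size, hs.mem.reg, hs.mem.arr⟩
    pend := by simp [Config.useAux, hs.pend]
    aux := by
      simp only [Config.useAux, Config.answerSpace, hs.pend]
      omega
    depth := by simpa using hd }

theorem Run.next_some {z f : ℕ} {X : Set V} {l : List (Set V)} {r : List (List (Set V))}
    (hz : z < 6) (hf : 0 < f) (hf' : f < 16) (h : st.pend = (X :: l) :: r) :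
    Run E D (.next (arrayAddr z) (.const f)) st a
      ({ st with pend := l :: r }.setArr z X |>.setReg f 1)
      (a + ((arrayAddr z).size + 2 + n)) := fun s hs => by
  refine ⟨_, .next_some _ _ s X l r (hs.pend.trans h), Describes.tick ?_ _⟩
  have := array_end_le (n := n) hz
  have h1 := hs.top
  rw [hs.mem.eval_addr]
  have hm : ({ st with pend := l :: r } : AState V).Models E.v s.mem :=
    ⟨hs.mem.size, hs.mem.reg, hs.mem.arr⟩
  have hd := hs.depth
  exact { hs with
    mem := (hm.write_set (k := z) X { s with pending := l :: r } rfl).update_reg hf hf' 1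
    pend := rfl
    top := by simp only [Config.write, Config.writeSet, Expr.eval]; omega
    depth := by rw [h] at hd; simpa using hd }

theorem Run.next_close {z f : ℕ} {r : List (List (Set V))}
    (hf : 0 < f) (hf' : f < 16) (h : st.pend = [] :: r) :
    Run E D (.next (arrayAddr z) (.const f)) st a ({ st with pend := r }.setReg f 0)
      (a + ((arrayAddr z).size + 2 + n)) := fun s hs => by
  refine ⟨_, .next_close _ _ s r (hs.pend.trans h), Describes.tick ?_ _⟩
  have h1 := hs.top
  have hm : ({ st with pend := r } : AState V).Models E.v s.mem :=
    ⟨hs.mem.size, hs.mem.reg, hs.mem.arr⟩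
  have hd := hs.depth
  exact { hs with
    mem := hm.update_reg hf hf' 0
    pend := rfl
    top := by simp only [Config.write, Expr.eval]; omega
    depth := by rw [h] at hd; simp at hd ⊢; omega }

open Classical in
theorem Run.volume {x f : ℕ} (hx : x < 6) (hf : 0 < f) (hf' : f < 16) :
    Run E D (.volume (arrayAddr x) (.const f)) st a
      (st.setReg f (if 0 < E.ρ (st.arr x) then 1 else 0))
      (a + ((arrayAddr x).size + 2 + n + E.θρt)) := fun s hs => by
  have h1 := hs.top
  have h2 := hs.aux
  have h3 := hs.answerSpace_le
  have hX : s.setAt E.v ((arrayAddr x).eval s.mem) = st.arr x := by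
    rw [hs.mem.eval_addr, hs.mem.setAt_eq hx s rfl]
  split_ifs with h
  · refine ⟨_, .volume_pos _ _ s (by rwa [hX]), Describes.tick ?_ _⟩
    exact { hs with
      mem := hs.mem.update_reg hf hf' 1
      top := by simp only [Config.useAux, Config.write, Expr.eval]; omega
      aux := by
        simp only [Config.useAux, Config.write, Config.answerSpace] at h3 ⊢
        omega }
  · refine ⟨_, .volume_nonpos _ _ s (by rw [hX]; exact not_lt.1 h), Describes.tick ?_ _⟩
    exact { hs with
      mem := hs.mem.update_reg hf hf' 0
      top := by simp only [Config.useAux, Config.write, Expr.eval]; omega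
      aux := by
        simp only [Config.useAux, Config.write, Config.answerSpace] at h3 ⊢
        omega }

/-- An output is allowed once the time since the previous one is known to be within the delay;
it sets that time back to `0`. -/
theorem Run.output {x : ℕ} (hx : x < 6) (hD : a + ((arrayAddr x).size + 1 + n) ≤ D) :
    Run E D (.output (arrayAddr x)) st a { st with outs := st.outs ++ [st.arr x] } 0 :=
    fun s hs => by
  refine ⟨_, .output _ _, ?_⟩
  rw [hs.mem.eval_addr, hs.mem.setAt_eq hx s rfl]
  exact { hs with
    mem := ⟨hs.mem.size, hs.mem.reg, hs.mem.arr⟩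
    outs := by simp [hs.outs]
    chain := by
      rw [List.map_append, ← List.cons_append, List.isChain_append]
      refine ⟨hs.chain, by simp, fun t ht t' ht' => ?_⟩
      have := hs.time t ht
      simp at ht'
      omega
    time := fun t ht => by
      rw [List.map_append, ← List.cons_append, List.getLast?_append] at ht
      simp at ht
      simp [ht] }

/-- The loop that counts the register `k` down to `0`. -/
def countdown (k : ℕ) (P : Cmd) : Cmd :=
  .loop (.load (.const k)) (.seq (.store (.const k) (.minus (.load (.const k)) (.const 1))) P)

/-- A loop counting down from `N` with an invariant `I`, indexed by the value of the counter, and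
time at most `t` for each execution of the body. -/
theorem Run.countdown {k t : ℕ} (hk : 0 < k) (hk' : k < 16) (I : ℕ → AState V → Prop)
    (hI : ∀ j < n, ∀ st, I (j + 1) st → ∃ st', I j st' ∧ st'.reg k = j ∧
      ∀ a, Run E D P (st.setReg k j) a st' (a + t))
    (N : ℕ) (hN : N ≤ n) (st : AState V) (h : I N st) (hr : st.reg k = N) :
    ∃ st', I 0 st' ∧ st'.reg k = 0 ∧
      ∀ a, Run E D (countdown k P) st a st' (a + (N * (t + 9) + 3)) := by
  induction N generalizing st with
  | zero =>
    refine ⟨st, h, hr, fun a => ?_⟩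
    refine (Run.loop_false fun m hm => ?_).mono (by simp [Expr.size])
    simp [Expr.eval, hm.reg k hk', hr]
  | succ j ih =>
    obtain ⟨st', h1, h2, h3⟩ := hI j (by omega) st h
    obtain ⟨st'', h4, h5, h6⟩ := ih (by omega) st' h1 h2
    refine ⟨st'', h4, h5, fun a => ?_⟩
    refine (Run.loop_true (fun m hm => ?_) (Run.seq
      (Run.store_reg hk hk' (x := j) (fun m hm => ?_) (by omega)) (h3 _)) (h6 _)).mono ?_
    · simp [Expr.eval, hm.reg k hk', hr]
    · simp [Expr.eval, hm.reg k hk', hr]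
    · simp only [Expr.size]
      have : (j + 1) * (t + 9) = j * (t + 9) + (t + 9) := by ring
      omega

end Runs

/-! ### Copying and comparing sets -/

namespace AState

variable {V : Type u}

theorem setReg_setReg (st : AState V) (k x y : ℕ) :
    (st.setReg k x).setReg k y = st.setReg k y := by
  simp [setReg]

theorem setArr_setArr (st : AState V) (k : ℕ) (X Y : Set V) :
    (st.setArr k X).setArr k Y = st.setArr k Y := by
  simp [setArr]

theorem setArr_setReg (st : AState V) (k l x : ℕ) (X : Set V) :
    (st.setArr k X).setReg l x = (st.setReg l x).setArr k X := rfl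

theorem setReg_comm (st : AState V) {k l : ℕ} (h : k ≠ l) (x y : ℕ) :
    (st.setReg k x).setReg l y = (st.setReg l y).setReg k x := by
  simp [setReg, Function.update_comm h]

theorem setArr_self (st : AState V) (k : ℕ) : st.setArr k (st.arr k) = st := by
  simp [setArr]

end AState

/-- Do nothing. -/
def skip : Cmd := .loop (.const 0) (.store (.const 0) (.const 0))

/-- The expression for the entry of the `k`-th set whose index is in register `l`. -/
def entry (k l : ℕ) : Expr := .load (.plus (arrayAddr k) (.load (.const l)))

/-- Copy the `a`-th set to the `b`-th one. -/
def copySet (a b : ℕ) : Cmd :=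
  .seq (.store (.const 11) (.load (.const 0)))
    (countdown 11 (.store (.plus (arrayAddr b) (.load (.const 11))) (entry a 11)))

/-- Set register `r` to whether the `a`-th and the `b`-th set are equal. -/
def compareSets (a b r : ℕ) : Cmd :=
  .seq (.store (.const r) (.const 1)) <|
  .seq (.store (.const 11) (.load (.const 0)))
    (countdown 11 (.cond
      (.plus (.minus (entry a 11) (entry b 11)) (.minus (entry b 11) (entry a 11)))
      (.store (.const r) (.const 0)) skip))

theorem arrayAddr_size (k : ℕ) : (arrayAddr k).size = 3 * k + 1 := by
  induction k with
  | zero => rfl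
  | succ k ih => simp [arrayAddr, Expr.size, ih]; ring

theorem entry_size (k l : ℕ) : (entry k l).size = 3 * k + 5 := by
  simp [entry, Expr.size, arrayAddr_size]

section Routines

variable {V : Type u} {n : ℕ} {E : Env V n} {D : ℕ} {st st' : AState V} {a b : ℕ}

theorem run_skip : Run E D skip st a st (a + 2) :=
  Run.loop_false fun _ _ => rfl

open Classical in
theorem AState.Models.eval_entry {v : Fin n ≃ V} {m : ℕ → ℕ} (h : st.Models v m) {k l : ℕ}
    (hk : k < 6) (hl : l < 16) {j : Fin n} (hj : st.reg l = j) :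
    (entry k l).eval m = if v j ∈ st.arr k then 1 else 0 := by
  simp [entry, Expr.eval, h.eval_addr, h.reg l hl, hj, h.arr k hk]

theorem run_erase {k l : ℕ} (j : Fin n) (hk : k < 6) (hl : l < 16) (hj : st.reg l = j) :
    Run E D (.store (.plus (arrayAddr k) (.load (.const l))) (.const 0)) st a
      (st.setArr k (st.arr k \ {E.v j})) (a + (3 * k + 6)) := by
  convert Run.store_arr (p := False) (x := 0) (e := .const 0) j hk hl hj (fun m _ => rfl)
    (by simp) using 2
  · ext u
    by_cases hu : u = E.v j <;> simp [hu]
  · simp [arrayAddr_size, Expr.size]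

theorem run_insert {k l : ℕ} (j : Fin n) (hk : k < 6) (hl : l < 16) (hj : st.reg l = j) :
    Run E D (.store (.plus (arrayAddr k) (.load (.const l))) (.const 1)) st a
      (st.setArr k (insert (E.v j) (st.arr k))) (a + (3 * k + 6)) := by
  convert Run.store_arr (p := True) (x := 1) (e := .const 1) j hk hl hj (fun m _ => rfl)
    (by simp) using 2
  · ext u
    by_cases hu : u = E.v j <;> simp [hu]
  · simp [arrayAddr_size, Expr.size]

theorem run_loadSize {k : ℕ} (hk : 0 < k) (hk' : k < 16) :
    Run E D (.store (.const k) (.load (.const 0))) st a (st.setReg k n) (a + 4) := fun s hs =>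
  Run.store_reg (E := E) (D := D) (a := a) (x := n) (e := .load (.const 0)) hk hk'
    (fun m hm => by simp [Expr.eval, hm.reg 0 (by norm_num), hm.size]) (by omega) s hs

theorem run_copySet {k l : ℕ} (hk : k < 6) (hl : l < 6) (hkl : k ≠ l) :
    Run E D (copySet k l) st a ((st.setReg 11 0).setArr l (st.arr k)) (a + (50 * n + 10)) := by
  classical
  obtain ⟨st', ⟨X, rfl, hX⟩, -, h⟩ := Run.countdown (E := E) (D := D) (k := 11)
    (P := .store (.plus (arrayAddr l) (.load (.const 11))) (entry k 11)) (t := 40)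
    (by norm_num) (by norm_num)
    (fun j st' => ∃ X, st' = (st.setReg 11 j).setArr l X ∧
      ∀ i : Fin n, j ≤ i → (E.v i ∈ X ↔ E.v i ∈ st.arr k))
    (fun j hj st' ⟨X, hst, hX⟩ => by
      subst hst
      refine ⟨_, ⟨{u | if u = E.v ⟨j, hj⟩ then E.v ⟨j, hj⟩ ∈ st.arr k else u ∈ X}, rfl, ?_⟩, ?_,
        fun a => ?_⟩
      · intro i hi
        by_cases h : i = ⟨j, hj⟩
        · subst h; simp
        · have h' : (i : ℕ) ≠ j := fun h' => h (Fin.ext h')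
          simpa [h] using hX i (by omega)
      · simp
      · rw [AState.setArr_setReg, AState.setReg_setReg]
        have := Run.store_arr (E := E) (D := D) (a := a)
          (st := (st.setReg 11 j).setArr l X) (l := 11) (e := entry k 11)
          (p := E.v ⟨j, hj⟩ ∈ st.arr k) ⟨j, hj⟩ hl (by norm_num) (by simp)
          (fun m hm => by
            rw [hm.eval_entry hk (by norm_num) (j := ⟨j, hj⟩) (by simp)]) (by simp [hkl])
        rw [AState.setArr_setArr] at this
        simp only [AState.setArr_arr, if_pos] at this
        refine this.mono ?_
        rw [arrayAddr_size, entry_size]; omega)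
    n le_rfl (st.setReg 11 n) ⟨st.arr l, (AState.setArr_self (st.setReg 11 n) l).symm,
      fun i hi => absurd i.2 (by omega)⟩ (by simp)
  have hX' : X = st.arr k := by
    ext x
    obtain ⟨i, rfl⟩ := E.v.surjective x
    exact hX i (Nat.zero_le _)
  subst hX'
  exact (Run.seq (run_loadSize (by norm_num) (by norm_num)) (h _)).mono (by omega)

open Classical in
theorem run_compareSets {k l r : ℕ} (hk : k < 6) (hl : l < 6) (hr : 0 < r) (hr' : r < 11) :
    Run E D (compareSets k l r) st a
      ((st.setReg r (if st.arr k = st.arr l then 1 else 0)).setReg 11 0)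
      (a + (100 * n + 20)) := by
  let B : ℕ → Prop := fun j => ∀ i : Fin n, j ≤ i → (E.v i ∈ st.arr k ↔ E.v i ∈ st.arr l)
  obtain ⟨st', rfl, -, h⟩ := Run.countdown (E := E) (D := D) (k := 11)
    (P := .cond
      (.plus (.minus (entry k 11) (entry l 11)) (.minus (entry l 11) (entry k 11)))
      (.store (.const r) (.const 0)) skip) (t := 90)
    (by norm_num) (by norm_num)
    (fun j st' => st' = (st.setReg r (if B j then 1 else 0)).setReg 11 j)
    (fun j hj st' hst => by
      subst hst
      refine ⟨_, rfl, by simp, fun a => ?_⟩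
      rw [AState.setReg_setReg]
      have hev : ∀ m, ((st.setReg r (if B (j + 1) then 1 else 0)).setReg 11 j).Models E.v m →
          (Expr.plus (.minus (entry k 11) (entry l 11)) (.minus (entry l 11) (entry k 11))).eval m
            = if (E.v ⟨j, hj⟩ ∈ st.arr k ↔ E.v ⟨j, hj⟩ ∈ st.arr l) then 0 else 1 := by
        intro m hm
        simp only [Expr.eval]
        rw [hm.eval_entry hk (by norm_num) (j := ⟨j, hj⟩) (by simp),
          hm.eval_entry hl (by norm_num) (j := ⟨j, hj⟩) (by simp)]
        by_cases h1 : E.v ⟨j, hj⟩ ∈ st.arr k <;> by_cases h2 : E.v ⟨j, hj⟩ ∈ st.arr l <;>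
          simp [h1, h2]
      by_cases hc : E.v ⟨j, hj⟩ ∈ st.arr k ↔ E.v ⟨j, hj⟩ ∈ st.arr l
      · have hB : B j ↔ B (j + 1) := by
          refine ⟨fun h i hi => h i (by omega), fun h i hi => ?_⟩
          by_cases hij : i = ⟨j, hj⟩
          · rwa [hij]
          · exact h i (by have : (i : ℕ) ≠ j := fun h' => hij (Fin.ext h'); omega)
        simp only [hB]
        refine (Run.cond_false (fun m hm => ?_) run_skip).mono ?_
        · rw [hev m hm, if_pos hc]
        · simp only [Expr.size, entry_size]; omega
      · have hB : ¬ B j := fun h => hc (h ⟨j, hj⟩ le_rfl)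
        simp only [hB, if_false]
        have := Run.store_reg (E := E) (D := D) (k := r) (x := 0) (e := .const 0)
          (st := (st.setReg r (if B (j + 1) then 1 else 0)).setReg 11 j)
          (a := a + ((Expr.plus (.minus (entry k 11) (entry l 11))
            (.minus (entry l 11) (entry k 11))).size + 1)) hr (by omega)
          (fun m _ => rfl) (by omega)
        have hst : ((st.setReg r (if B (j + 1) then 1 else 0)).setReg 11 j).setReg r 0 =
            (st.setReg r 0).setReg 11 j := by
          rw [AState.setReg_comm _ (by omega), AState.setReg_setReg]
        rw [hst] at this
        refine (Run.cond_true (fun m hm => ?_) this).mono ?_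
        · rw [hev m hm, if_neg hc]; norm_num
        · simp only [Expr.size, entry_size]; omega)
    n le_rfl ((st.setReg r 1).setReg 11 n)
    (by rw [if_pos (show B n from fun i hi => absurd i.2 (by omega))]) (by simp)
  have hB : B 0 ↔ st.arr k = st.arr l := by
    refine ⟨fun h => ?_, fun h i _ => by rw [h]⟩
    ext x
    obtain ⟨i, rfl⟩ := E.v.surjective x
    exact h i (Nat.zero_le _)
  simp only [hB] at h
  refine (Run.seq (Run.store_reg (x := 1) (e := .const 1) hr (by omega) (fun m _ => rfl) (by omega))
    (Run.seq (run_loadSize (by norm_num) (by norm_num)) (h _))).mono ?_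
  simp only [Expr.size]; omega

/-! ### Computing the parent -/

open Classical in
/-- One step of the computation of the parent of `T`: delete the `j`-th element from the current
set `y.1`, unless `T` is maximal in what remains; in that case record `j` as the key `y.2`. -/
noncomputable def pruneStep (E : Env V n) (T : Set V) (j : ℕ) (y : Set V × ℕ) : Set V × ℕ :=
  if h : j < n then
    if E.v ⟨j, h⟩ ∈ T then y
    else if T = E.L₁ T (y.1 \ {E.v ⟨j, h⟩}) then (insert (E.v ⟨j, h⟩) (y.1 \ {E.v ⟨j, h⟩}), j)
    else (y.1 \ {E.v ⟨j, h⟩}, y.2)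
  else y

/-- The steps for the elements with index `j - 1, …, 0`. -/
noncomputable def prune (E : Env V n) (T : Set V) : ℕ → Set V × ℕ → Set V × ℕ
  | 0, y => y
  | j + 1, y => prune E T j (pruneStep E T j y)

/-- The parent of `T`: a component that is minimal among those strictly above `T`, found by
deleting elements from `V` greedily. -/
noncomputable def parent (E : Env V n) (T : Set V) : Set V := (prune E T n (Set.univ, n)).1

/-- The index of an element of the parent of `T` that is not in `T`. -/
noncomputable def key (E : Env V n) (T : Set V) : ℕ := (prune E T n (Set.univ, n)).2

/-- Compute the parent of the set number `1` as set number `2`, and its key in register `6`.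
This uses the set number `3` and the registers `9`, `10` and `11`. -/
def findParent : Cmd :=
  .seq (copySet 4 2) <|
  .seq (.store (.const 6) (.load (.const 0))) <|
  .seq (.store (.const 10) (.load (.const 0))) <|
  countdown 10 <|
    .cond (entry 1 10) skip <|
    .seq (.store (.plus (arrayAddr 2) (.load (.const 10))) (.const 0)) <|
    .seq (.first (arrayAddr 1) (arrayAddr 2) (arrayAddr 3)) <|
    .seq (compareSets 1 3 9) <|
    .cond (.load (.const 9))
      (.seq (.store (.plus (arrayAddr 2) (.load (.const 10))) (.const 1))
        (.store (.const 6) (.load (.const 10))))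
      skip

/-- `st'` agrees with `st` except in the registers `6, …, 11` and the sets `1`, `2`, `3`, which
the main loop uses only within one iteration. -/
structure AState.SameFrame (st st' : AState V) : Prop where
  reg : ∀ k, k < 6 → st'.reg k = st.reg k
  arr : ∀ k, k = 0 ∨ k = 4 ∨ k = 5 → st'.arr k = st.arr k
  pend : st'.pend = st.pend
  outs : st'.outs = st.outs

theorem run_findParent (hn : 1 ≤ n) (hU : st.arr 4 = Set.univ) :
    ∃ st' : AState V, st.SameFrame st' ∧ st'.reg 7 = st.reg 7 ∧ st'.reg 8 = st.reg 8 ∧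
      st'.arr 1 = st.arr 1 ∧ st'.arr 2 = parent E (st.arr 1) ∧ st'.reg 6 = key E (st.arr 1) ∧
      st'.reg 6 ≤ n ∧
      ∀ a, Run E D findParent st a st' (a + 400 * (n ^ 2 + n * E.θ₁t)) := by
  classical
  obtain ⟨st', ⟨h1, h2, h3, h4, h5, h6⟩, -, h⟩ := Run.countdown (E := E) (D := D) (k := 10)
    (P := .cond (entry 1 10) skip <|
      .seq (.store (.plus (arrayAddr 2) (.load (.const 10))) (.const 0)) <|
      .seq (.first (arrayAddr 1) (arrayAddr 2) (arrayAddr 3)) <|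
      .seq (compareSets 1 3 9) <|
      .cond (.load (.const 9))
        (.seq (.store (.plus (arrayAddr 2) (.load (.const 10))) (.const 1))
          (.store (.const 6) (.load (.const 10))))
        skip) (t := 101 * n + 100 + E.θ₁t)
    (by norm_num) (by norm_num)
    (fun j st' => st.SameFrame st' ∧ st'.reg 7 = st.reg 7 ∧ st'.reg 8 = st.reg 8 ∧
      st'.arr 1 = st.arr 1 ∧ st'.reg 6 ≤ n ∧
      prune E (st.arr 1) j (st'.arr 2, st'.reg 6) = prune E (st.arr 1) n (Set.univ, n))
    (fun j hj st' ⟨h1, h2, h3, h4, h5, h6⟩ => by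
      by_cases hT : E.v ⟨j, hj⟩ ∈ st.arr 1
      · refine ⟨st'.setReg 10 j, ⟨⟨fun k hk => ?_, h1.arr, h1.pend, h1.outs⟩, by simpa using h2,
          by simpa using h3, h4, by simpa using h5, ?_⟩, by simp, fun a => ?_⟩
        · rw [AState.setReg_reg, if_neg (by omega), h1.reg k hk]
        · rw [← h6]
          simp [prune, pruneStep, hj, hT]
        · refine (Run.cond_true (fun m hm => ?_) run_skip).mono ?_
          · rw [hm.eval_entry (by norm_num) (by norm_num) (j := ⟨j, hj⟩) (by simp)]
            simp [h4, hT]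
          · rw [entry_size]; omega
      have hcond : ∀ m, (st'.setReg 10 j).Models E.v m → (entry 1 10).eval m = 0 := by
        intro m hm
        rw [hm.eval_entry (by norm_num) (by norm_num) (j := ⟨j, hj⟩) (by simp)]
        simp [h4, hT]
      set Y := st'.arr 2 \ {E.v ⟨j, hj⟩} with hY
      set Z := E.L₁ (st.arr 1) Y with hZ
      set st₁ := ((st'.setReg 10 j).setArr 2 Y).setArr 3 Z with hst₁
      set st₂ := (st₁.setReg 9 (if st.arr 1 = Z then 1 else 0)).setReg 11 0 with hst₂
      have hrun : ∀ a, ∀ P st₃ b, Run E D P st₂ (a + (101 * n + E.θ₁t + 60)) st₃ b →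
          Run E D (.seq (.store (.plus (arrayAddr 2) (.load (.const 10))) (.const 0)) <|
            .seq (.first (arrayAddr 1) (arrayAddr 2) (arrayAddr 3)) <|
            .seq (compareSets 1 3 9) P) (st'.setReg 10 j) a st₃ b := by
        intro a P st₃ b hP
        refine Run.seq (run_erase ⟨j, hj⟩ (by norm_num) (by norm_num) (by simp)) ?_
        refine Run.seq (Run.first (by norm_num) (by norm_num) (by norm_num)) ?_
        have hc := run_compareSets (E := E) (D := D) (k := 1) (l := 3) (r := 9) (st := st₁)
          (a := a + (3 * 2 + 6) + ((arrayAddr 1).size + (arrayAddr 2).size +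
            (arrayAddr 3).size + 1 + n + E.θ₁t)) (by norm_num) (by norm_num)
            (by norm_num) (by norm_num)
        have e1 : st₁.arr 1 = st.arr 1 := by simp [hst₁, h4]
        have e3 : st₁.arr 3 = Z := by simp [hst₁]
        rw [e1, e3] at hc
        have hc' := Run.seq (hc.mono (d := a + (101 * n + E.θ₁t + 60)) (by
          simp only [arrayAddr_size]; omega)) hP
        simpa [hst₁, hZ, hY, h4] using hc'
      by_cases hL : st.arr 1 = Z
      · refine ⟨(st₂.setArr 2 (insert (E.v ⟨j, hj⟩) Y)).setReg 6 j,
          ⟨⟨fun k hk => ?_, fun k hk => ?_, h1.pend, h1.outs⟩, ?_, ?_, ?_, ?_, ?_⟩, ?_,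
          fun a => ?_⟩
        · rw [← h1.reg k hk]
          simp [hst₂, hst₁]
          grind
        · rw [← h1.arr k hk]
          simp [hst₂, hst₁]
          grind
        · simpa [hst₂, hst₁] using h2
        · simpa [hst₂, hst₁] using h3
        · simpa [hst₂, hst₁] using h4
        · simp; omega
        · rw [← h6]
          have : st.arr 1 = E.L₁ (st.arr 1) (st'.arr 2 \ {E.v ⟨j, hj⟩}) := hL
          simp only [prune, pruneStep, hj, hT, dif_pos, if_false]
          rw [if_pos this]
          simp [hY]
        · simp [hst₂, hst₁]
        · refine (Run.cond_false hcond (hrun _ _ _ _ (Run.cond_true (fun m hm => ?_)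
            (Run.seq (run_insert ⟨j, hj⟩ (by norm_num) (by norm_num) ?_)
              (Run.store_reg (x := j) (by norm_num) (by norm_num) (fun m hm => ?_)
                (by omega)))))).mono ?_
          · simp [Expr.eval, hm.reg 9, hst₂, hL]
          · simp [hst₂, hst₁]
          · simp [Expr.eval, hm.reg 10, hst₂, hst₁]
          · simp only [entry_size, Expr.size]; omega
      · refine ⟨st₂,
          ⟨⟨fun k hk => ?_, fun k hk => ?_, h1.pend, h1.outs⟩, ?_, ?_, ?_, ?_, ?_⟩, ?_,
          fun a => ?_⟩
        · rw [← h1.reg k hk]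
          simp [hst₂, hst₁]
          grind
        · rw [← h1.arr k hk]
          simp [hst₂, hst₁]
          grind
        · simpa [hst₂, hst₁] using h2
        · simpa [hst₂, hst₁] using h3
        · simpa [hst₂, hst₁] using h4
        · simpa [hst₂, hst₁] using h5
        · rw [← h6]
          have : ¬ st.arr 1 = E.L₁ (st.arr 1) (st'.arr 2 \ {E.v ⟨j, hj⟩}) := hL
          simp only [prune, pruneStep, hj, hT, dif_pos, if_false]
          rw [if_neg this]
          simp [hY, hst₂, hst₁]
        · simp [hst₂, hst₁]
        · refine (Run.cond_false hcond (hrun _ _ _ _ (Run.cond_false (fun m hm => ?_)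
            run_skip))).mono ?_
          · simp [Expr.eval, hm.reg 9, hst₂, hL]
          · simp only [entry_size, Expr.size]; omega)
    n le_rfl ((((st.setReg 11 0).setArr 2 (st.arr 4)).setReg 6 n).setReg 10 n)
    ⟨⟨fun k hk => by simp; grind, fun k hk => by simp; grind, rfl, rfl⟩, by simp, by simp, by simp,
      by simp, by simp [hU]⟩ (by simp)
  refine ⟨st', h1, h2, h3, h4, ?_, ?_, h5, fun a => ?_⟩
  · simpa [prune, parent] using congrArg Prod.fst h6
  · simpa [prune, key] using congrArg Prod.snd h6
  · refine (Run.seq (run_copySet (by norm_num) (by norm_num) (by norm_num)) (Run.seq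
      (run_loadSize (by norm_num) (by norm_num)) (Run.seq
      (run_loadSize (by norm_num) (by norm_num)) (h _)))).mono ?_
    nlinarith
end Routines

/-! ### The program -/

/-- Look for components below the current node that avoid the current index: ask the second oracle
about the node without that element, or go to the next index if nothing is left. -/
def openAnswer : Cmd :=
  .seq (copySet 0 2) <|
  .seq (.store (.plus (arrayAddr 2) (.load (.const 5))) (.const 0)) <|
  .seq (compareSets 2 5 9) <|
  .cond (.load (.const 9))
    (.store (.const 5) (.plus (.load (.const 5)) (.const 1)))
    (.seq (.second (arrayAddr 2)) (.store (.const 2) (.const 0)))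

/-- Make the candidate the current node, and output it if its depth is odd. -/
def enterNode : Cmd :=
  .seq (copySet 1 0) <|
  .seq (.store (.const 3) (.plus (.load (.const 3)) (.const 1))) <|
  .seq (.store (.const 4) (.minus (.const 1) (.load (.const 4)))) <|
  .seq (.store (.const 5) (.const 0)) <|
  .seq (.store (.const 2) (.const 1)) <|
  .cond (.load (.const 4)) (.output (arrayAddr 0)) skip

/-- Output the current node if its depth is even, and go back to its parent and its key, or from
depth `1` to the set `V` and the index `n`. At depth `0`, stop. -/
def leaveNode : Cmd :=
  .cond (.load (.const 3))
    (.seq (.cond (.load (.const 4)) skip (.output (arrayAddr 0))) <|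
     .seq (.store (.const 3) (.minus (.load (.const 3)) (.const 1))) <|
     .seq (.store (.const 4) (.minus (.const 1) (.load (.const 4)))) <|
     .seq (.store (.const 2) (.const 0)) <|
     .cond (.load (.const 3))
       (.seq (copySet 0 1) <| .seq findParent <| .seq (copySet 2 0)
         (.store (.const 5) (.load (.const 6))))
       (.seq (copySet 4 0) (.store (.const 5) (.load (.const 0)))))
    (.store (.const 1) (.const 0))

/-- Enter the candidate if it is `ρ`-positive and, at positive depth, if the current node and the
current index are its parent and its key. -/
def examineCandidate : Cmd :=
  .seq (.volume (arrayAddr 1) (.const 8)) <|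
  .cond (.load (.const 8))
    (.cond (.load (.const 3))
      (.seq findParent <| .seq (compareSets 2 0 9) <|
        .cond (.load (.const 9))
          (.cond (.plus (.minus (.load (.const 5)) (.load (.const 6)))
            (.minus (.load (.const 6)) (.load (.const 5)))) skip enterNode)
          skip)
      enterNode)
    skip

/-- One round of the main loop. -/
def searchRound : Cmd :=
  .cond (.load (.const 2))
    (.cond (.minus (.load (.const 0)) (.load (.const 5))) openAnswer leaveNode)
    (.seq (.next (arrayAddr 1) (.const 7)) <|
      .cond (.load (.const 7)) examineCandidate
        (.seq (.store (.const 5) (.plus (.load (.const 5)) (.const 1)))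
          (.store (.const 2) (.const 1))))

/-- The main loop. -/
def searchLoop : Cmd := .loop (.load (.const 1)) searchRound

/-- Prepare the search: the current node is `V`, at depth `0`, the current index is `n`, and the
second oracle has been asked about `V`. -/
def prepare : Cmd :=
  .seq (.store (.const 11) (.load (.const 0))) <|
  .seq (countdown 11 (.store (.plus (arrayAddr 4) (.load (.const 11))) (.const 1))) <|
  .seq (copySet 4 0) <|
  .seq (.store (.const 1) (.const 1)) <|
  .seq (.store (.const 5) (.load (.const 0)))
    (.second (arrayAddr 4))

/-- The enumeration algorithm. -/
def enumerator : Cmd := .seq prepare searchLoop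

/-! ### Rounds of the main loop -/

/-- Where the search stands: the current node, its depth in the family tree, the current index,
a flag that is `1` if the answer of the second oracle for this index is still to be requested and
`0` if it is being read, the open answers, and the outputs. -/
structure SearchPoint (V : Type u) where
  node : Set V
  depth : ℕ
  index : ℕ
  flag : ℕ
  pend : List (List (Set V))
  outs : List (Set V)

section Rounds

variable {V : Type u} {n : ℕ}

/-- The state `st` has the search standing at `x`. -/
structure AState.At (st : AState V) (x : SearchPoint V) : Prop where
  run : st.reg 1 = 1
  flag : st.reg 2 = x.flag
  depth : st.reg 3 = x.depth
  parity : st.reg 4 = x.depth % 2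
  index : st.reg 5 = x.index
  node : st.arr 0 = x.node
  univ : st.arr 4 = Set.univ
  empty : st.arr 5 = ∅
  pend : st.pend = x.pend
  outs : st.outs = x.outs

theorem AState.At.congr {st st' : AState V} {x : SearchPoint V} (h : st.At x)
    (h' : st.SameFrame st') : st'.At x where
  run := by rw [h'.reg 1 (by norm_num), h.run]
  flag := by rw [h'.reg 2 (by norm_num), h.flag]
  depth := by rw [h'.reg 3 (by norm_num), h.depth]
  parity := by rw [h'.reg 4 (by norm_num), h.parity]
  index := by rw [h'.reg 5 (by norm_num), h.index]
  node := by rw [h'.arr 0 (by simp), h.node]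
  univ := by rw [h'.arr 4 (by simp), h.univ]
  empty := by rw [h'.arr 5 (by simp), h.empty]
  pend := by rw [h'.pend, h.pend]
  outs := by rw [h'.outs, h.outs]

/-- Rounds of the main loop lead from `x` to `y`, and the time since the last output is at most
`a` before and at most `b` after them. -/
def Reach (E : Env V n) (D : ℕ) (x : SearchPoint V) (a : ℕ) (y : SearchPoint V) (b : ℕ) : Prop :=
  ∀ s, (∃ st : AState V, st.At x ∧ Describes E D st a s) →
    ∃ s', (∃ st : AState V, st.At y ∧ Describes E D st b s') ∧
      ∀ s'', Exec E searchLoop s' s'' → Exec E searchLoop s s''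

variable {E : Env V n} {D : ℕ} {x y z : SearchPoint V} {a b c : ℕ}

theorem Reach.refl : Reach E D x a x a := fun s hs => ⟨s, hs, fun _ h => h⟩

theorem Reach.trans (h : Reach E D x a y b) (h' : Reach E D y b z c) : Reach E D x a z c :=
  fun s hs =>
  let ⟨s', h1, h2⟩ := h s hs
  let ⟨s'', h3, h4⟩ := h' s' h1
  ⟨s'', h3, fun _ he => h2 _ (h4 _ he)⟩

theorem Reach.mono (h : Reach E D x a y b) (hb : b ≤ c) : Reach E D x a y c := fun s hs =>
  let ⟨s', ⟨st, h1, h2⟩, h3⟩ := h s hs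
  ⟨s', ⟨st, h1, h2.mono hb⟩, h3⟩

theorem Reach.trans_le (h : Reach E D x a y b) {b' : ℕ} (h' : Reach E D y b' z c) (hb : b ≤ b') :
    Reach E D x a z c :=
  (h.mono hb).trans h'

theorem Reach.of_run
    (h : ∀ st : AState V, st.At x → ∃ st', st'.At y ∧ Run E D searchRound st (a + 3) st' b) :
    Reach E D x a y b := by
  rintro s ⟨st, h1, h2⟩
  obtain ⟨st', h3, h4⟩ := h st h1
  obtain ⟨s', h5, h6⟩ := h4 _ (h2.tick 3)
  refine ⟨s', ⟨st', h3, h6⟩, fun s'' he => .loop_true _ _ _ _ _ ?_ h5 he⟩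
  simp [Expr.eval, h2.mem.reg 1, h1.run]

theorem searchRound_of_flag {st st' : AState V} {P : Cmd} (h : st.reg 2 ≠ 0)
    (hP : P = if st.reg 5 < n then openAnswer else leaveNode) (hr : Run E D P st (a + 9) st' b) :
    Run E D searchRound st a st' b := by
  refine Run.cond_true (fun m hm => by simpa [Expr.eval, hm.reg 2] using h) ?_
  split_ifs at hP with hi
  · subst hP
    exact Run.cond_true (fun m hm => by
      simp only [Expr.eval, hm.reg 0 (by norm_num), hm.reg 5 (by norm_num), hm.size]
      omega) hr
  · subst hP
    exact Run.cond_false (fun m hm => by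
      simp only [Expr.eval, hm.reg 0 (by norm_num), hm.reg 5 (by norm_num), hm.size]
      omega) hr

variable {S : Set V} {d i : ℕ} {p : List (List (Set V))} {o : List (Set V)}


/-- `openAnswer` up to its last instruction, after which it is known whether the current node
without the current element is empty. -/
theorem run_openAnswer {st : AState V} (h : st.At ⟨S, d, i, 1, p, o⟩) (hi : i < n) :
    ∃ st₁ : AState V, st₁.At ⟨S, d, i, 1, p, o⟩ ∧ st₁.arr 2 = S \ {E.v ⟨i, hi⟩} ∧
      (st₁.reg 9 = 0 ↔ S \ {E.v ⟨i, hi⟩} ≠ ∅) ∧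
      ∀ a st' b, Run E D (.cond (.load (.const 9))
          (.store (.const 5) (.plus (.load (.const 5)) (.const 1)))
          (.seq (.second (arrayAddr 2)) (.store (.const 2) (.const 0)))) st₁ (a + 200 * n) st' b →
        Run E D openAnswer st a st' b := by
  classical
  set st₀ := (((st.setReg 11 0).setArr 2 S).setArr 2 (S \ {E.v ⟨i, hi⟩})) with hst₀
  refine ⟨(st₀.setReg 9 (if st₀.arr 2 = st₀.arr 5 then 1 else 0)).setReg 11 0, ?_, ?_, ?_, ?_⟩
  · refine h.congr ⟨fun k hk => ?_, fun k hk => ?_, rfl, rfl⟩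
    · simp [hst₀]; grind
    · simp [hst₀]; grind
  · simp [hst₀]
  · simp [hst₀, h.empty]
  · intro a st' b hr
    have h0 := h.node
    dsimp only at h0
    refine Run.seq (run_copySet (by norm_num) (by norm_num) (by norm_num)) (Run.seq
      (run_erase ⟨i, hi⟩ (by norm_num) (by norm_num) (by simpa using h.index)) (Run.seq
      ((run_compareSets (by norm_num) (by norm_num) (by norm_num) (by norm_num)).mono
        (d := a + 200 * n) (by omega)) ?_))
    simpa [h0, hst₀] using hr

theorem reach_skip (hn : 1 ≤ n) (hi : i < n) (hS : S \ {E.v ⟨i, hi⟩} = ∅) :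
    Reach E D ⟨S, d, i, 1, p, o⟩ a ⟨S, d, i + 1, 1, p, o⟩ (a + 400 * n) := by
  refine Reach.of_run fun st h => ?_
  obtain ⟨st₁, h1, -, h3, h4⟩ := run_openAnswer (E := E) (D := D) h hi
  refine ⟨st₁.setReg 5 (i + 1), ?_, ?_⟩
  · constructor <;> simp [h1.run, h1.flag, h1.depth, h1.parity, h1.node, h1.univ, h1.empty,
      h1.pend, h1.outs]
  · refine searchRound_of_flag (by simp [h.flag])
      (if_pos (show st.reg 5 < n by rw [h.index]; exact hi)).symm (h4 _ _ _ ?_)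
    have h9 : st₁.reg 9 ≠ 0 := fun h9 => h3.1 h9 hS
    refine (Run.cond_true (fun m hm => by simpa [Expr.eval, hm.reg 9] using h9)
      (Run.store_reg (x := i + 1) (by norm_num) (by norm_num) (fun m hm => ?_) (by omega))).mono ?_
    · simp [Expr.eval, hm.reg 5, h1.index]
    · simp only [Expr.size]; omega

theorem reach_open (hn : 1 ≤ n) (hi : i < n) (hS : S \ {E.v ⟨i, hi⟩} ≠ ∅) (hp : p.length ≤ n) :
    Reach E D ⟨S, d, i, 1, p, o⟩ a ⟨S, d, i, 0, E.L₂ (S \ {E.v ⟨i, hi⟩}) :: p, o⟩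
      (a + (400 * n + E.θ₂t)) := by
  refine Reach.of_run fun st h => ?_
  obtain ⟨st₁, h1, h2, h3, h4⟩ := run_openAnswer (E := E) (D := D) h hi
  refine ⟨({ st₁ with pend := E.L₂ (st₁.arr 2) :: st₁.pend } : AState V).setReg 2 0, ?_, ?_⟩
  · constructor <;> simp [h1.run, h1.index, h1.depth, h1.parity, h1.node, h1.univ, h1.empty,
      h1.pend, h1.outs, h2]
  · refine searchRound_of_flag (by simp [h.flag])
      (if_pos (show st.reg 5 < n by rw [h.index]; exact hi)).symm (h4 _ _ _ ?_)
    have h9 : st₁.reg 9 = 0 := h3.2 hS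
    refine (Run.cond_false (fun m hm => by simpa [Expr.eval, hm.reg 9] using h9)
      (Run.seq (Run.second (by norm_num) (by rw [h1.pend]; exact hp))
        (Run.store_reg (x := 0) (e := .const 0) (by norm_num) (by norm_num) (fun m hm => ?_)
        (by omega)))).mono ?_
    · simp [Expr.eval]
    · simp only [Expr.size, arrayAddr_size]; omega

theorem searchRound_of_reading {st st' : AState V} {b : ℕ} (h : st.At ⟨S, d, i, 0, p, o⟩)
    (hr : Run E D (.seq (.next (arrayAddr 1) (.const 7)) <|
      .cond (.load (.const 7)) examineCandidate
        (.seq (.store (.const 5) (.plus (.load (.const 5)) (.const 1)))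
          (.store (.const 2) (.const 1)))) st (a + 3) st' b) :
    Run E D searchRound st a st' b :=
  Run.cond_false (fun m hm => by simp [Expr.eval, hm.reg 2, h.flag]) hr

theorem reach_close (hn : 1 ≤ n) (hi : i ≤ n) :
    Reach E D ⟨S, d, i, 0, [] :: p, o⟩ a ⟨S, d, i + 1, 1, p, o⟩ (a + 50 * n) := by
  refine Reach.of_run fun st h => ?_
  refine ⟨((({ st with pend := p } : AState V).setReg 7 0).setReg 5 (i + 1)).setReg 2 1, ?_, ?_⟩
  · constructor <;> simp [h.run, h.depth, h.parity, h.node, h.univ, h.empty, h.outs]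
  · refine searchRound_of_reading h ((Run.seq (Run.next_close (by norm_num)
      (by norm_num) h.pend) (Run.cond_false (fun m hm => ?_) (Run.seq
        (Run.store_reg (x := i + 1) (by norm_num) (by norm_num) (fun m hm => ?_) (by omega))
        (Run.store_reg (x := 1) (e := .const 1) (by norm_num) (by norm_num) (fun m hm => ?_)
          (by omega))))).mono ?_)
    · simp [Expr.eval, hm.reg 7]
    · simp [Expr.eval, hm.reg 5, h.index]
    · simp [Expr.eval]
    · simp only [Expr.size, arrayAddr_size]; omega

/-- The condition under which a candidate is entered. -/
def Accepted (E : Env V n) (S : Set V) (d i : ℕ) (T : Set V) : Prop :=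
  0 < E.ρ T ∧ (d ≠ 0 → parent E T = S ∧ key E T = i)

/-- The time in which a candidate is examined, up to a constant. -/
def Env.candidateTime (E : Env V n) : ℕ := n ^ 2 + n * E.θ₁t + E.θρt

theorem Env.le_candidateTime (E : Env V n) : n ≤ E.candidateTime := by
  unfold Env.candidateTime
  nlinarith [Nat.le_self_pow (n := 2) (by norm_num) n]

theorem run_enterNode (hn : 1 ≤ n) {st : AState V} {f : ℕ} {T : Set V}
    (h : st.At ⟨S, d, i, f, p, o⟩) (hT : st.arr 1 = T) (hd : d < n) (hD : a + 100 * n ≤ D) :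
    ∃ st' : AState V,
      st'.At ⟨T, d + 1, 0, 1, p, if (d + 1) % 2 = 1 then o ++ [T] else o⟩ ∧
      Run E D enterNode st a st' (if (d + 1) % 2 = 1 then 0 else a + 100 * n) := by
  set st₁ := (((((st.setReg 11 0).setArr 0 T).setReg 3 (d + 1)).setReg 4 ((d + 1) % 2)).setReg
    5 0).setReg 2 1 with hst₁
  have hrun : ∀ st' b, Run E D (.cond (.load (.const 4)) (.output (arrayAddr 0)) skip) st₁
      (a + (50 * n + 30)) st' b → Run E D enterNode st a st' b := by
    intro st' b hr
    have h1 := run_copySet (E := E) (D := D) (k := 1) (l := 0) (st := st) (a := a) (by norm_num)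
      (by norm_num) (by norm_num)
    rw [hT] at h1
    refine Run.seq h1 (Run.seq (Run.store_reg (x := d + 1) (by norm_num) (by norm_num)
      (fun m hm => ?_) (by omega)) (Run.seq (Run.store_reg (x := (d + 1) % 2) (by norm_num)
      (by norm_num) (fun m hm => ?_) (by omega)) (Run.seq (Run.store_reg (x := 0)
      (e := .const 0) (by norm_num) (by norm_num) (fun m hm => rfl) (by omega)) (Run.seq
      ((Run.store_reg (x := 1) (e := .const 1) (by norm_num) (by norm_num)
      (fun m hm => rfl) (by omega)).mono ?_) hr))))
    · simp [Expr.eval, hm.reg 3, h.depth]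
    · simp [Expr.eval, hm.reg 4, h.parity]
      omega
    · simp only [Expr.size]; omega
  split_ifs with hp
  · refine ⟨{ st₁ with outs := st₁.outs ++ [st₁.arr 0] }, ?_, ?_⟩
    · constructor <;> simp [hst₁, h.run, h.univ, h.empty, h.pend, h.outs]
    · refine hrun _ _ (Run.cond_true (fun m hm => ?_) (Run.output (by norm_num) ?_))
      · simp [Expr.eval, hm.reg 4, hst₁, hp]
      · simp only [Expr.size, arrayAddr_size]; omega
  · refine ⟨st₁, ?_, ?_⟩
    · constructor <;> simp [hst₁, h.run, h.univ, h.empty, h.pend, h.outs]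
    · refine hrun _ _ ((Run.cond_false (fun m hm => ?_) run_skip).mono ?_)
      · simp [Expr.eval, hm.reg 4, hst₁]
        omega
      · simp only [Expr.size]; omega

variable {T : Set V} {l : List (Set V)} {r : List (List (Set V))}

/-- A round that takes a candidate, up to the point where its `ρ`-positivity is known. -/
theorem searchRound_examine {st : AState V} (h : st.At ⟨S, d, i, 0, (T :: l) :: r, o⟩) :
    ∃ st₁ : AState V, st₁.At ⟨S, d, i, 0, l :: r, o⟩ ∧ st₁.arr 1 = T ∧
      (st₁.reg 8 = 0 ↔ ¬ 0 < E.ρ T) ∧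
      ∀ a st' b, Run E D (.cond (.load (.const 8))
        (.cond (.load (.const 3))
          (.seq findParent <| .seq (compareSets 2 0 9) <|
            .cond (.load (.const 9))
              (.cond (.plus (.minus (.load (.const 5)) (.load (.const 6)))
                (.minus (.load (.const 6)) (.load (.const 5)))) skip enterNode)
              skip)
          enterNode)
        skip) st₁ (a + (2 * n + 24 + E.θρt)) st' b → Run E D searchRound st a st' b := by
  classical
  set st₀ := (({ st with pend := l :: r } : AState V).setArr 1 T).setReg 7 1 with hst₀
  have hT : st₀.arr 1 = T := by simp [hst₀]
  refine ⟨st₀.setReg 8 (if 0 < E.ρ T then 1 else 0), ?_, hT, ?_, ?_⟩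
  · constructor <;> simp [hst₀, h.run, h.flag, h.depth, h.parity, h.index, h.node, h.univ, h.empty,
      h.outs]
  · simp
  · intro a st' b hr
    refine searchRound_of_reading h (Run.seq (Run.next_some (by norm_num)
      (by norm_num) (by norm_num) h.pend) (Run.cond_true (fun m hm => ?_) (Run.seq
      ((Run.volume (by norm_num) (by norm_num) (by norm_num)).mono
        (d := a + (2 * n + 24 + E.θρt)) ?_) ?_)))
    · simp [Expr.eval, hm.reg 7]
    · simp only [Expr.size, arrayAddr_size]; omega
    · rw [hT]; exact hr

/-- The examination of a candidate at positive depth, up to the point where its parent and key are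
known. -/
theorem searchRound_check (hn : 1 ≤ n) {st : AState V}
    (h : st.At ⟨S, d, i, 0, l :: r, o⟩) (hd : d ≠ 0) :
    ∃ st₁ : AState V, st₁.At ⟨S, d, i, 0, l :: r, o⟩ ∧ st₁.arr 1 = st.arr 1 ∧
      st₁.reg 6 = key E (st.arr 1) ∧
      (st₁.reg 9 = 0 ↔ parent E (st.arr 1) ≠ S) ∧
      ∀ a st' b, Run E D (.cond (.load (.const 9))
              (.cond (.plus (.minus (.load (.const 5)) (.load (.const 6)))
                (.minus (.load (.const 6)) (.load (.const 5)))) skip enterNode)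
              skip) st₁ (a + (500 * (n ^ 2 + n * E.θ₁t) + 30)) st' b →
        Run E D (.cond (.load (.const 3))
          (.seq findParent <| .seq (compareSets 2 0 9) <|
            .cond (.load (.const 9))
              (.cond (.plus (.minus (.load (.const 5)) (.load (.const 6)))
                (.minus (.load (.const 6)) (.load (.const 5)))) skip enterNode)
              skip)
          enterNode) st a st' b := by
  classical
  obtain ⟨st₀, h1, -, -, h4, h5, h6, -, h8⟩ := run_findParent (E := E) (D := D) hn h.univ
  have h0 := h.congr h1
  refine ⟨(st₀.setReg 9 (if st₀.arr 2 = st₀.arr 0 then 1 else 0)).setReg 11 0,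
    h0.congr ⟨fun k hk => by simp; grind, fun k hk => rfl, rfl, rfl⟩, h4, by simpa using h6, ?_, ?_⟩
  · simp [h0.node, h5]
  · intro a st' b hr
    refine Run.cond_true (fun m hm => by simpa [Expr.eval, hm.reg 3, h.depth] using hd)
      (Run.seq (h8 _) (Run.seq ((run_compareSets (by norm_num) (by norm_num) (by norm_num)
        (by norm_num)).mono ?_) hr))
    simp only [Expr.size]
    nlinarith [Nat.le_self_pow (n := 2) (by norm_num) n]

theorem reach_accept (hn : 1 ≤ n) (hT : Accepted E S d i T) (hd : d < n)
    (hD : a + 1000 * E.candidateTime ≤ D) :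
    Reach E D ⟨S, d, i, 0, (T :: l) :: r, o⟩ a
      ⟨T, d + 1, 0, 1, l :: r, if (d + 1) % 2 = 1 then o ++ [T] else o⟩
      (if (d + 1) % 2 = 1 then 0 else a + 1000 * E.candidateTime) := by
  have hc := E.le_candidateTime
  refine Reach.of_run fun st h => ?_
  obtain ⟨st₁, h1, h2, h3, h4⟩ := searchRound_examine (E := E) (D := D) h
  have h8 : st₁.reg 8 ≠ 0 := fun h8 => h3.1 h8 hT.1
  by_cases hd0 : d = 0
  · obtain ⟨st', h5, h6⟩ := run_enterNode (E := E) (D := D)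
      (a := a + 3 + (2 * n + 24 + E.θρt) + 6) hn h1 h2 hd (by
        unfold Env.candidateTime at *
        omega)
    refine ⟨st', h5, (h4 _ _ _ (Run.cond_true (fun m hm => ?_) (Run.cond_false (fun m hm => ?_)
      h6))).mono ?_⟩
    · simpa [Expr.eval, hm.reg 8] using h8
    · simpa [Expr.eval, hm.reg 3, h1.depth] using hd0
    · unfold Env.candidateTime at *
      split_ifs <;> omega
  · obtain ⟨st₂, h5, h6, h7, h9, h10⟩ := searchRound_check (E := E) (D := D) hn h1 hd0
    rw [h2] at h6 h7 h9
    obtain ⟨hp, hk⟩ := hT.2 hd0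
    have h9' : st₂.reg 9 ≠ 0 := fun h' => h9.1 h' hp
    obtain ⟨st', h11, h12⟩ := run_enterNode (E := E) (D := D)
      (a := a + 3 + (2 * n + 24 + E.θρt) + 3 + (500 * (n ^ 2 + n * E.θ₁t) + 30) + 3 + 12)
      hn h5 h6 hd (by
        unfold Env.candidateTime at *
        omega)
    refine ⟨st', h11, (h4 _ _ _ (Run.cond_true (fun m hm => ?_) (h10 _ _ _ (Run.cond_true
      (fun m hm => ?_) (Run.cond_false (fun m hm => ?_) h12))))).mono ?_⟩
    · simpa [Expr.eval, hm.reg 8] using h8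
    · simpa [Expr.eval, hm.reg 9] using h9'
    · simp [Expr.eval, hm.reg 5, hm.reg 6, h7, hk, h5.index]
    · unfold Env.candidateTime at *
      split_ifs <;> omega

theorem reach_reject (hn : 1 ≤ n) (hT : ¬ Accepted E S d i T) :
    Reach E D ⟨S, d, i, 0, (T :: l) :: r, o⟩ a ⟨S, d, i, 0, l :: r, o⟩
      (a + 1000 * E.candidateTime) := by
  have hc := E.le_candidateTime
  refine Reach.of_run fun st h => ?_
  obtain ⟨st₁, h1, h2, h3, h4⟩ := searchRound_examine (E := E) (D := D) h
  by_cases hρ : 0 < E.ρ T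
  · have h8 : st₁.reg 8 ≠ 0 := fun h8 => h3.1 h8 hρ
    have hd0 : d ≠ 0 := by
      rintro rfl
      exact hT ⟨hρ, fun h => absurd rfl h⟩
    obtain ⟨st₂, h5, h6, h7, h9, h10⟩ := searchRound_check (E := E) (D := D) hn h1 hd0
    rw [h2] at h6 h7 h9
    by_cases hp : parent E T = S
    · have h9' : st₂.reg 9 ≠ 0 := fun h' => h9.1 h' hp
      have hk : key E T ≠ i := fun hk => hT ⟨hρ, fun _ => ⟨hp, hk⟩⟩
      refine ⟨st₂, h5, (h4 _ _ _ (Run.cond_true (fun m hm => ?_) (h10 _ _ _ (Run.cond_true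
        (fun m hm => ?_) (Run.cond_true (fun m hm => ?_) run_skip))))).mono ?_⟩
      · simpa [Expr.eval, hm.reg 8] using h8
      · simpa [Expr.eval, hm.reg 9] using h9'
      · simp only [Expr.eval, hm.reg 5 (by norm_num), hm.reg 6 (by norm_num), h7, h5.index]
        omega
      · unfold Env.candidateTime at *
        simp only [Expr.size]
        omega
    · refine ⟨st₂, h5, (h4 _ _ _ (Run.cond_true (fun m hm => ?_) (h10 _ _ _ (Run.cond_false
        (fun m hm => ?_) run_skip)))).mono ?_⟩
      · simpa [Expr.eval, hm.reg 8] using h8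
      · simpa [Expr.eval, hm.reg 9] using h9.2 hp
      · unfold Env.candidateTime at *
        simp only [Expr.size]
        omega
  · refine ⟨st₁, h1, (h4 _ _ _ (Run.cond_false (fun m hm => ?_) run_skip)).mono ?_⟩
    · simpa [Expr.eval, hm.reg 8] using h3.2 hρ
    · unfold Env.candidateTime at *
      simp only [Expr.size]
      omega

/-- Leaving a node at positive depth, up to the return to its parent. -/
theorem run_leaveNode {st : AState V} (hd : d ≠ 0)
    (hdn : d ≤ n) (h : st.At ⟨S, d, i, 1, p, o⟩) (hD : a + 20 * n + 30 ≤ D) :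
    ∃ st₁ : AState V, st₁.At ⟨S, d - 1, i, 0, p, if d % 2 = 1 then o else o ++ [S]⟩ ∧
      ∀ st' b, Run E D (.cond (.load (.const 3))
       (.seq (copySet 0 1) <| .seq findParent <| .seq (copySet 2 0)
         (.store (.const 5) (.load (.const 6))))
       (.seq (copySet 4 0) (.store (.const 5) (.load (.const 0))))) st₁
        (if d % 2 = 1 then a + 30 else 30) st' b → Run E D leaveNode st a st' b := by
  have hrun : ∀ (st₀ : AState V) c, st₀.At ⟨S, d, i, 1, p, if d % 2 = 1 then o else o ++ [S]⟩ →
      Run E D (.cond (.load (.const 4)) skip (.output (arrayAddr 0))) st (a + 3) st₀ c →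
      ∀ st' b, Run E D (.cond (.load (.const 3))
       (.seq (copySet 0 1) <| .seq findParent <| .seq (copySet 2 0)
         (.store (.const 5) (.load (.const 6))))
       (.seq (copySet 4 0) (.store (.const 5) (.load (.const 0)))))
        (((st₀.setReg 3 (d - 1)).setReg 4 ((d + 1) % 2)).setReg 2 0) (c + 15) st' b →
        Run E D leaveNode st a st' b := by
    intro st₀ c h0 hr st' b hr'
    refine Run.cond_true (fun m hm => by simpa [Expr.eval, hm.reg 3, h.depth] using hd)
      (Run.seq hr (Run.seq (Run.store_reg (x := d - 1) (by norm_num) (by norm_num)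
      (fun m hm => ?_) (by omega)) (Run.seq (Run.store_reg (x := (d + 1) % 2) (by norm_num)
      (by norm_num) (fun m hm => ?_) (by omega)) (Run.seq ((Run.store_reg (x := 0)
      (e := .const 0) (by norm_num) (by norm_num) (fun m hm => rfl) (by omega)).mono ?_) hr'))))
    · simp [Expr.eval, hm.reg 3, h0.depth]
    · simp [Expr.eval, hm.reg 4, h0.parity]
      omega
    · simp only [Expr.size]; omega
  split_ifs at hrun ⊢ with hp
  · refine ⟨((st.setReg 3 (d - 1)).setReg 4 ((d + 1) % 2)).setReg 2 0, ?_, fun st' b hr =>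
      hrun st (a + 15) h ((Run.cond_true (fun m hm => ?_) run_skip).mono ?_) _ _ hr⟩
    · constructor <;> simp [h.run, h.index, h.node, h.univ, h.empty, h.pend, h.outs]
      omega
    · simp [Expr.eval, hm.reg 4, h.parity, hp]
    · simp only [Expr.size]; omega
  · refine ⟨((({ st with outs := st.outs ++ [st.arr 0] } : AState V).setReg 3 (d - 1)).setReg 4
      ((d + 1) % 2)).setReg 2 0, ?_, fun st' b hr =>
      hrun _ 15 ?_ ((Run.cond_false (fun m hm => ?_) (Run.output (by norm_num) ?_)).mono ?_) _ _ hr⟩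
    · constructor <;> simp [h.run, h.index, h.node, h.univ, h.empty, h.pend, h.outs]
      omega
    · constructor <;> simp [h.run, h.index, h.node, h.univ, h.empty, h.pend, h.outs, h.flag,
        h.depth, h.parity]
    · simp [Expr.eval, hm.reg 4, h.parity]
      omega
    · simp only [Expr.size, arrayAddr_size]; omega
    · omega

theorem reach_leave_root (hn : 1 ≤ n) (hi : n ≤ i) (hD : a + 100 * n ≤ D) :
    Reach E D ⟨S, 1, i, 1, p, o⟩ a ⟨Set.univ, 0, n, 0, p, o⟩ (a + 200 * n) := by
  refine Reach.of_run fun st h => ?_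
  obtain ⟨st₁, h1, h2⟩ := run_leaveNode (E := E) (D := D) (a := a + 12) one_ne_zero hn h (by omega)
  refine ⟨((st₁.setReg 11 0).setArr 0 (st₁.arr 4)).setReg 5 n, ?_,
    searchRound_of_flag (by simp [h.flag])
      (if_neg (show ¬ st.reg 5 < n by rw [h.index]; exact not_lt.2 hi)).symm (h2 _ _ ?_)⟩
  · constructor <;> simp [h1.run, h1.flag, h1.depth, h1.parity, h1.univ, h1.empty, h1.pend, h1.outs]
  · refine (Run.cond_false (fun m hm => ?_) (Run.seq (run_copySet (by norm_num) (by norm_num)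
      (by norm_num)) (run_loadSize (by norm_num) (by norm_num)))).mono ?_
    · simp [Expr.eval, hm.reg 3, h1.depth]
    · simp only [Expr.size, Nat.one_mod, if_true]
      omega

theorem reach_leave (hn : 1 ≤ n) (hi : n ≤ i) (hd : 1 < d) (hdn : d ≤ n) (hD : a + 100 * n ≤ D) :
    Reach E D ⟨S, d, i, 1, p, o⟩ a
      ⟨parent E S, d - 1, key E S, 0, p, if d % 2 = 1 then o else o ++ [S]⟩
      (if d % 2 = 1 then a + 1000 * E.candidateTime else 1000 * E.candidateTime) := by
  have hc := E.le_candidateTime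
  refine Reach.of_run fun st h => ?_
  obtain ⟨st₁, h1, h2⟩ := run_leaveNode (E := E) (D := D) (a := a + 12) (by omega) hdn h (by omega)
  obtain ⟨st₂, h3, -, -, -, h7, h8, h9, h10⟩ := run_findParent (E := E) (D := D)
    (st := (st₁.setReg 11 0).setArr 1 S) hn (by simp [h1.univ])
  have h4 : ((st₁.setReg 11 0).setArr 1 S).At
      ⟨S, d - 1, i, 0, p, if d % 2 = 1 then o else o ++ [S]⟩ :=
    h1.congr ⟨fun k hk => by simp; grind, fun k hk => by simp; grind, rfl, rfl⟩
  have h5 := h4.congr h3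
  refine ⟨((st₂.setReg 11 0).setArr 0 (st₂.arr 2)).setReg 5 (st₂.reg 6), ?_,
    searchRound_of_flag (by simp [h.flag])
      (if_neg (show ¬ st.reg 5 < n by rw [h.index]; exact not_lt.2 hi)).symm (h2 _ _ ?_)⟩
  · constructor <;> simp [h5.run, h5.flag, h5.depth, h5.parity, h5.univ, h5.empty, h5.pend, h5.outs,
      h7, h8]
  · have hcopy := run_copySet (E := E) (D := D) (k := 0) (l := 1) (st := st₁)
      (a := (if d % 2 = 1 then a + 3 + 9 + 30 else 30) + 3) (by norm_num) (by norm_num)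
      (by norm_num)
    rw [h1.node] at hcopy
    refine (Run.cond_true (fun m hm => ?_) (Run.seq hcopy (Run.seq (h10 _) (Run.seq
      (run_copySet (by norm_num) (by norm_num) (by norm_num))
      (Run.store_reg (by norm_num) (by norm_num) (fun m hm => ?_) (by omega)))))).mono ?_
    · simp only [Expr.eval, hm.reg 3 (by norm_num), h1.depth]
      omega
    · simp [Expr.eval, hm.reg 6]
    · unfold Env.candidateTime at *
      simp only [Expr.size]
      split_ifs <;> omega

/-- At depth `0` and past the last index, the main loop ends. -/
theorem searchLoop_end (hi : n ≤ i) {s : Config V}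
    (h : ∃ st : AState V, st.At ⟨S, 0, i, 1, p, o⟩ ∧ Describes E D st a s) :
    ∃ s' st', Exec E searchLoop s s' ∧ Describes E D st' (a + 30) s' ∧ st'.outs = o := by
  obtain ⟨st, h, hs⟩ := h
  have : Run E D searchLoop st a (st.setReg 1 0) (a + 30) := by
    refine (Run.loop_true (fun m hm => by simp [Expr.eval, hm.reg 1, h.run])
      (searchRound_of_flag (by simp [h.flag])
        (if_neg (show ¬ st.reg 5 < n by rw [h.index]; exact not_lt.2 hi)).symm
        (Run.cond_false (fun m hm => by simp [Expr.eval, hm.reg 3, h.depth])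
          (Run.store_reg (x := 0) (e := .const 0) (by norm_num) (by norm_num) (fun m hm => rfl)
            (by omega)))) (Run.loop_false fun m hm => by simp [Expr.eval, hm.reg 1])).mono ?_
    simp only [Expr.size]
    omega
  obtain ⟨s', h1, h2⟩ := this s hs
  exact ⟨s', _, h1, h2, h.outs⟩

/-! ### The start of the search -/

theorem describes_init (E : Env V n) (D : ℕ) :
    Describes E D ⟨fun k => if k = 0 then n else 0, fun _ => ∅, [], []⟩ 0 (Config.init V n) where
  mem := ⟨rfl, fun k _ => rfl, fun k _ j => by simp [Config.init]⟩
  pend := rfl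
  outs := rfl
  chain := by simp [Config.init]
  time t ht := by simp [Config.init]
  top := by simp only [Config.init]; omega
  aux := by simp [Config.init]
  depth := by simp

theorem run_prepare (E : Env V n) (D : ℕ) (hn : 1 ≤ n) :
    ∃ st : AState V, st.At ⟨Set.univ, 0, n, 0, [E.L₂ Set.univ], []⟩ ∧
      Run E D prepare ⟨fun k => if k = 0 then n else 0, fun _ => ∅, [], []⟩ 0 st
        (200 * n + E.θ₂t) := by
  classical
  set st₀ : AState V := ⟨fun k => if k = 0 then n else 0, fun _ => ∅, [], []⟩ with hst₀
  obtain ⟨st', ⟨X, rfl, hX⟩, -, h⟩ := Run.countdown (E := E) (D := D) (k := 11)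
    (P := .store (.plus (arrayAddr 4) (.load (.const 11))) (.const 1)) (t := 20)
    (by norm_num) (by norm_num)
    (fun j st' => ∃ X, st' = (st₀.setReg 11 j).setArr 4 X ∧ ∀ i : Fin n, j ≤ i → E.v i ∈ X)
    (fun j hj st' ⟨X, hst, hX⟩ => by
      subst hst
      refine ⟨_, ⟨insert (E.v ⟨j, hj⟩) X, rfl, ?_⟩, by simp, fun a => ?_⟩
      · intro i hi
        by_cases h : i = ⟨j, hj⟩
        · subst h; simp
        · have h' : (i : ℕ) ≠ j := fun h' => h (Fin.ext h')
          exact Set.mem_insert_of_mem _ (hX i (by omega))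
      · rw [AState.setArr_setReg, AState.setReg_setReg]
        have := run_insert (E := E) (D := D) (a := a) (st := (st₀.setReg 11 j).setArr 4 X)
          (k := 4) (l := 11) ⟨j, hj⟩ (by norm_num) (by norm_num) (by simp)
        rw [AState.setArr_setArr] at this
        simp only [AState.setArr_arr, if_pos] at this
        exact this.mono (by omega))
    n le_rfl (st₀.setReg 11 n) ⟨st₀.arr 4, (AState.setArr_self (st₀.setReg 11 n) 4).symm,
      fun i hi => absurd i.2 (by omega)⟩ (by simp)
  have hX' : X = Set.univ := by
    ext x
    obtain ⟨i, rfl⟩ := E.v.surjective x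
    simpa using hX i (Nat.zero_le _)
  subst hX'
  refine ⟨_, ?_, (Run.seq (run_loadSize (by norm_num) (by norm_num)) (Run.seq (h _) (Run.seq
    (run_copySet (by norm_num) (by norm_num) (by norm_num)) (Run.seq
    (Run.store_reg (x := 1) (e := .const 1) (by norm_num) (by norm_num) (fun m hm => rfl)
      (by omega)) (Run.seq (run_loadSize (by norm_num) (by norm_num))
    (Run.second (by norm_num) (by simp [hst₀]))))))).mono ?_⟩
  · constructor <;> simp [hst₀]
  · simp only [Expr.size, arrayAddr_size]
    omega

end Rounds

/-! ### The family tree of the components -/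

/-- The oracles answer for the family `C`, the volume function is monotone, and `∅` is not a
`ρ`-positive component. -/
structure Env.Admissible {V : Type u} {n : ℕ} (E : Env V n) (C : Set (Set V)) : Prop where
  pos : 1 ≤ n
  first : IsFirstOracle C E.L₁
  second : IsSecondOracle C E.L₂
  mono : Monotone E.ρ
  empty : ∅ ∈ C → E.ρ ∅ ≤ 0

section FamilyTree

variable {V : Type u} {n : ℕ} {E : Env V n} {C : Set (Set V)} {T S : Set V}

theorem Env.finite (E : Env V n) : Finite V := Finite.of_equiv _ E.v

theorem Env.Admissible.nonempty (h : E.Admissible C) (hT : T ∈ C) (hρ : 0 < E.ρ T) :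
    T.Nonempty := by
  rw [Set.nonempty_iff_ne_empty]
  rintro rfl
  exact absurd (h.empty hT) (not_le.2 hρ)

/-- The answer of the first oracle is `T` itself exactly if `T` is maximal in `Y`. -/
theorem IsFirstOracle.eq_iff [Finite V] {L : Set V → Set V → Set V} (h : IsFirstOracle C L)
    (hT : T ∈ C) (hne : T.Nonempty) {Y : Set V} (hY : T ⊆ Y) :
    T = L T Y ↔ ¬ ∃ W ∈ C, T ⊂ W ∧ W ⊆ Y := by
  rcases h T Y hne hY with h | ⟨h, -⟩
  · obtain ⟨⟨h1, h2, h3⟩, h4⟩ := h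
    constructor
    · rintro he ⟨W, hW, hTW, hWY⟩
      exact h3 W hW hWY (he ▸ hTW)
    · intro hno
      by_contra hne
      exact hno ⟨_, h1, h4.ssubset_of_ne hne, h2⟩
  · exfalso
    obtain ⟨W, hTW, hW⟩ := (Set.toFinite {W | W ∈ C ∧ W ⊆ Y}).exists_le_maximal ⟨hT, hY⟩
    have : W ∈ maxComponentsOver C T Y :=
      ⟨⟨hW.prop.1, hW.prop.2, fun X hX hXY hWX =>
        hWX.not_subset (hW.le_of_ge ⟨hX, hXY⟩ hWX.subset)⟩, hTW⟩
    rw [h] at this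
    exact this

theorem prune_induction {I : ℕ → Set V × ℕ → Prop}
    (hI : ∀ j < n, ∀ y, I (j + 1) y → I j (pruneStep E T j y)) :
    ∀ j ≤ n, ∀ y, I j y → I 0 (prune E T j y)
  | 0, _, _, h => h
  | j + 1, hj, y, h => prune_induction hI j (by omega) _ (hI j (by omega) y h)

/-- Once kept, an element is never deleted. This needs no assumption on `T`; if no element is kept,
the key is `n`. -/
theorem key_spec (h : key E T < n) : E.v ⟨key E T, h⟩ ∈ parent E T ∧ E.v ⟨key E T, h⟩ ∉ T := by
  have := prune_induction (E := E) (T := T)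
    (I := fun j y => ∀ h : y.2 < n, j ≤ y.2 ∧ E.v ⟨y.2, h⟩ ∈ y.1 ∧ E.v ⟨y.2, h⟩ ∉ T)
    (fun j hj y hy => by
      unfold pruneStep
      rw [dif_pos hj]
      split_ifs with h1 h2
      · exact fun h => ⟨by have := (hy h).1; omega, (hy h).2⟩
      · exact fun h => ⟨le_rfl, by simp, h1⟩
      · refine fun h => ⟨by have := (hy h).1; omega, ⟨(hy h).2.1, ?_⟩, (hy h).2.2⟩
        intro he
        have := congrArg Fin.val (E.v.injective he)
        have h' := (hy h).1
        simp only at this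
        omega) n le_rfl (Set.univ, n) (fun h => absurd h (lt_irrefl _))
  exact (this h).2

/-- The parent of a component that is not maximal is a minimal component strictly above it. -/
theorem parent_spec (hE : E.Admissible C) (hT : T ∈ C) (hne : T.Nonempty)
    (hW : ∃ W ∈ C, T ⊂ W) :
    parent E T ∈ C ∧ T ⊂ parent E T ∧ (∀ W ∈ C, T ⊂ W → ¬ W ⊂ parent E T) ∧ key E T < n := by
  have := E.finite
  have hinv := prune_induction (E := E) (T := T)
    -- an element that was kept stays indispensable, as the current set only shrinks
    (I := fun j y => (∃ W ∈ C, T ⊂ W ∧ W ⊆ y.1) ∧ (∀ i : Fin n, (i : ℕ) < j → E.v i ∈ y.1) ∧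
      ∀ i : Fin n, j ≤ (i : ℕ) → E.v i ∈ y.1 → E.v i ∉ T →
        y.2 < n ∧ ¬ ∃ W ∈ C, T ⊂ W ∧ W ⊆ y.1 \ {E.v i})
    (fun j hj y ⟨h1, h2, h3⟩ => by
      have hTy : T ⊆ y.1 := by
        obtain ⟨W, -, h4, h5⟩ := h1
        exact h4.subset.trans h5
      have hlt : ∀ i : Fin n, j ≤ (i : ℕ) → i ≠ ⟨j, hj⟩ → j + 1 ≤ (i : ℕ) := by
        intro i hi hij
        have : (i : ℕ) ≠ j := fun h => hij (Fin.ext h)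
        omega
      unfold pruneStep
      rw [dif_pos hj]
      split_ifs with h4 h5
      · refine ⟨h1, fun i hi => h2 i (by omega), fun i hi hiy hiT => h3 i (hlt i hi ?_) hiy hiT⟩
        rintro rfl
        exact hiT h4
      · have hins : insert (E.v ⟨j, hj⟩) (y.1 \ {E.v ⟨j, hj⟩}) = y.1 := by
          rw [Set.insert_sdiff_singleton, Set.insert_eq_of_mem (h2 _ (by simp))]
        rw [hins]
        refine ⟨h1, fun i hi => h2 i (by omega), fun i hi hiy hiT => ⟨hj, ?_⟩⟩
        by_cases hij : i = ⟨j, hj⟩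
        · subst hij
          exact (hE.first.eq_iff hT hne (Set.subset_sdiff_singleton hTy h4)).1 h5
        · exact (h3 i (hlt i hi hij) hiy hiT).2
      · refine ⟨?_, fun i hi => ⟨h2 i (by omega), fun he => ?_⟩, fun i hi hiy hiT => ?_⟩
        · by_contra hno
          exact h5 ((hE.first.eq_iff hT hne (Set.subset_sdiff_singleton hTy h4)).2 hno)
        · have := congrArg Fin.val (E.v.injective he)
          simp only at this
          omega
        · obtain ⟨h6, h7⟩ := h3 i (hlt i hi fun hij => hiy.2 (by simp [hij])) hiy.1 hiT
          refine ⟨h6, fun ⟨W, hW, hTW, hWy⟩ => h7 ⟨W, hW, hTW, hWy.trans ?_⟩⟩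
          exact Set.sdiff_subset_sdiff_left Set.sdiff_subset)
    n le_rfl (Set.univ, n) ⟨by simpa using hW, by simp, fun i hi => absurd i.2 (by omega)⟩
  obtain ⟨⟨W, hW, hTW, hWP⟩, -, h3⟩ := hinv
  change W ⊆ parent E T at hWP
  have hP : W = parent E T := by
    refine hWP.antisymm fun x hx => ?_
    by_contra hxW
    obtain ⟨i, rfl⟩ := E.v.surjective x
    exact (h3 i (Nat.zero_le _) hx fun h => hxW (hTW.subset h)).2
      ⟨W, hW, hTW, Set.subset_sdiff_singleton hWP hxW⟩
  subst hP
  obtain ⟨x, hx, hxT⟩ := Set.exists_of_ssubset hTW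
  obtain ⟨i, rfl⟩ := E.v.surjective x
  refine ⟨hW, hTW, fun X hX hTX hXP => ?_, (h3 i (Nat.zero_le _) hx hxT).1⟩
  obtain ⟨y, hy, hyX⟩ := Set.exists_of_ssubset hXP
  obtain ⟨k, rfl⟩ := E.v.surjective y
  exact (h3 k (Nat.zero_le _) hy fun h => hyX (hTX.subset h)).2
    ⟨X, hX, hTX, Set.subset_sdiff_singleton hXP.subset hyX⟩

/-- `T` is a `ρ`-positive component that is not maximal, and its parent is `S`. -/
structure IsChild (E : Env V n) (C : Set (Set V)) (T S : Set V) : Prop where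
  mem : T ∈ C
  pos : 0 < E.ρ T
  not_max : ∃ W ∈ C, T ⊂ W
  parent_eq : parent E T = S

theorem IsChild.ssubset (hE : E.Admissible C) (h : IsChild E C T S) : T ⊂ S :=
  h.parent_eq ▸ (parent_spec hE h.mem (hE.nonempty h.mem h.pos) h.not_max).2.1

theorem IsChild.key_lt (hE : E.Admissible C) (h : IsChild E C T S) : key E T < n :=
  (parent_spec hE h.mem (hE.nonempty h.mem h.pos) h.not_max).2.2.2

/-- The second oracle finds the children of `S` with key `i` below `S` without the `i`-th
element. -/
theorem isChild_iff (hE : E.Admissible C) (hS : S ∈ C) {i : ℕ} (hi : i < n) :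
    IsChild E C T S ∧ key E T = i ↔
      T ∈ maxComponents C (S \ {E.v ⟨i, hi⟩}) ∧ 0 < E.ρ T ∧ parent E T = S ∧ key E T = i := by
  constructor
  · rintro ⟨h, rfl⟩
    obtain ⟨-, h2, h3, -⟩ := parent_spec hE h.mem (hE.nonempty h.mem h.pos) h.not_max
    have hk := key_spec hi
    rw [h.parent_eq] at h2 h3 hk
    refine ⟨⟨h.mem, Set.subset_sdiff_singleton h2.subset hk.2, fun W hW hWS hTW => ?_⟩,
      h.pos, h.parent_eq, rfl⟩
    exact h3 W hW hTW ((Set.ssubset_iff_of_subset (hWS.trans Set.sdiff_subset)).2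
      ⟨_, hk.1, fun h => (hWS h).2 rfl⟩)
  · rintro ⟨h1, h2, h3, rfl⟩
    have hk := key_spec hi
    rw [h3] at hk
    exact ⟨⟨h1.1, h2, ⟨S, hS, (Set.ssubset_iff_of_subset (h1.2.1.trans Set.sdiff_subset)).2
      ⟨_, hk⟩⟩, h3⟩, rfl⟩

/-- The descendants of `S` in the family tree, including `S` itself. -/
def descendants (E : Env V n) (C : Set (Set V)) (S : Set V) : Set (Set V) :=
  {T | Relation.ReflTransGen (IsChild E C) T S}

theorem subset_of_mem_descendants (hE : E.Admissible C) (h : T ∈ descendants E C S) : T ⊆ S := by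
  induction h with
  | refl => exact subset_rfl
  | tail _ h ih => exact ih.trans (h.ssubset hE).subset

theorem mem_descendants_iff {X : Set V} :
    X ∈ descendants E C S ↔ X = S ∨ ∃ T, IsChild E C T S ∧ X ∈ descendants E C T := by
  unfold descendants
  rw [Set.mem_ofPred_eq, Relation.ReflTransGen.cases_tail_iff]
  constructor
  · rintro (h | ⟨T, h1, h2⟩)
    · exact Or.inl h.symm
    · exact Or.inr ⟨T, h2, h1⟩
  · rintro (h | ⟨T, h1, h2⟩)
    · exact Or.inl h.symm
    · exact Or.inr ⟨T, h2, h1⟩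

/-- Two subtrees with a common node are nested, since every node has only one parent. -/
theorem disjoint_descendants {R : Set V}
    (h₁ : ∀ U, IsChild E C T U → ¬ U ⊆ R) (h₂ : ∀ U, IsChild E C R U → ¬ U ⊆ T)
    (hE : E.Admissible C) (hne : T ≠ R) :
    Disjoint (descendants E C T) (descendants E C R) := by
  rw [Set.disjoint_left]
  intro X hXT hXR
  have hu : Relator.RightUnique (IsChild E C) := fun _ _ _ h h' =>
    h.parent_eq.symm.trans h'.parent_eq
  rcases Relation.ReflTransGen.total_of_right_unique hu hXT hXR with h | h
  · rcases Relation.ReflTransGen.cases_head h with h | ⟨U, h, h'⟩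
    · exact hne h
    · exact h₁ U h (subset_of_mem_descendants hE h')
  · rcases Relation.ReflTransGen.cases_head h with h | ⟨U, h, h'⟩
    · exact hne h.symm
    · exact h₂ U h (subset_of_mem_descendants hE h')

theorem IsChild.disjoint (hE : E.Admissible C) {R : Set V} (hT : IsChild E C T S)
    (hR : IsChild E C R S) (hne : T ≠ R) :
    Disjoint (descendants E C T) (descendants E C R) :=
  disjoint_descendants
    (fun _ hU h => (hR.ssubset hE).not_subset (hT.parent_eq ▸ hU.parent_eq ▸ h))
    (fun _ hU h => (hT.ssubset hE).not_subset (hR.parent_eq ▸ hU.parent_eq ▸ h)) hE hne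

theorem disjoint_of_maximal (hE : E.Admissible C) {R : Set V} (hT : T ∈ maxComponents C Set.univ)
    (hR : R ∈ maxComponents C Set.univ) (hne : T ≠ R) :
    Disjoint (descendants E C T) (descendants E C R) :=
  disjoint_descendants
    (fun _ hU => let ⟨W, hW, h⟩ := hU.not_max; absurd h (hT.2.2 W hW (Set.subset_univ _)))
    (fun _ hU => let ⟨W, hW, h⟩ := hU.not_max; absurd h (hR.2.2 W hW (Set.subset_univ _))) hE hne

/-- The `ρ`-positive components are the descendants of the maximal ones. -/
theorem exists_mem_descendants_iff (hE : E.Admissible C) :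
    (∃ R ∈ maxComponents C Set.univ, 0 < E.ρ R ∧ T ∈ descendants E C R) ↔ T ∈ C ∧ 0 < E.ρ T := by
  constructor
  · rintro ⟨R, hR, hρ, h⟩
    rcases Relation.ReflTransGen.cases_head h with h | ⟨U, h, -⟩
    · exact h ▸ ⟨hR.1, hρ⟩
    · exact ⟨h.mem, h.pos⟩
  -- climb from `T` to its ancestors, whose volume is at least that of `T`
  · have := E.finite
    induction T using WellFoundedGT.induction with
    | ind T ih =>
      rintro ⟨hT, hρ⟩
      by_cases hmax : ∃ W ∈ C, T ⊂ W
      · obtain ⟨h1, h2, -, -⟩ := parent_spec hE hT (hE.nonempty hT hρ) hmax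
        obtain ⟨R, hR, hR', h⟩ := ih _ h2 ⟨h1, hρ.trans_le (hE.mono h2.subset)⟩
        exact ⟨R, hR, hR', .head ⟨hT, hρ, hmax, rfl⟩ h⟩
      · exact ⟨T, ⟨hT, Set.subset_univ _, fun W hW _ hTW => hmax ⟨W, hW, hTW⟩⟩, hρ, .refl⟩

end FamilyTree

/-! ### The traversal of the family tree -/

/-- The list `L` contains every member of `F` exactly once and nothing else. -/
def ListsExactly {α : Type u} (L : List α) (F : Set α) : Prop :=
  L.Nodup ∧ ∀ x, x ∈ L ↔ x ∈ F

theorem ListsExactly.append {α : Type u} {L L' : List α} {F F' G : Set α}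
    (h : ListsExactly L F) (h' : ListsExactly L' F') (hd : Disjoint F F')
    (hG : ∀ x, x ∈ G ↔ x ∈ F ∨ x ∈ F') : ListsExactly (L ++ L') G := by
  refine ⟨List.nodup_append'.2 ⟨h.1, h'.1, fun x hx hx' => ?_⟩, fun x => ?_⟩
  · exact Set.disjoint_left.1 hd ((h.2 x).1 hx) ((h'.2 x).1 hx')
  · rw [List.mem_append, h.2, h'.2, hG]

section Traversal

variable {V : Type u} {n : ℕ}

/-- A bound, at a node of depth `d`, for the time since the last output, not counting the time
spent at this node. At odd depth the node was output when it was entered. At even depth the last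
output may be that of its parent, which has worked for a time of at most `W` since. -/
def startLag (W d : ℕ) : ℕ := if d % 2 = 1 then 0 else W

/-- At depth `d`, the search enters the subtree of `T` from the node `S` at the index `i`, outputs
all descendants of `T`, and returns to `S` and `i`. -/
def Visits (E : Env V n) (C : Set (Set V)) (W : ℕ) (S : Set V) (d i : ℕ) (T : Set V) : Prop :=
  d < n ∧ ∀ p o, p.length = d + 1 → ∃ L : List (Set V),
    ListsExactly (if (d + 1) % 2 = 1 then T :: L else L) (descendants E C T) ∧
    Reach E (2 * W) ⟨T, d + 1, 0, 1, p, o⟩ (startLag W (d + 1)) ⟨S, d, i, 0, p, o ++ L⟩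
      (startLag W d + 1000 * E.candidateTime)

variable {E : Env V n} {C : Set (Set V)} {W : ℕ} {S T : Set V} {d i w : ℕ}

/-- Reading an answer of the second oracle, where `w` is the time already spent at the node. Of the
time `2000 * E.candidateTime` for a candidate, one half is for its examination, and the other half
for the return from its subtree, which comes after the last output if the candidate is at even
depth. -/
theorem reach_scan (hn : 1 ≤ n) (hi : i ≤ n) (p : List (List (Set V)))
    (hp : p.length = d) (l : List (Set V)) (hl : l.Nodup)
    (hdisj : ∀ T ∈ l, ∀ R ∈ l, Accepted E S d i T → Accepted E S d i R → T ≠ R →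
      Disjoint (descendants E C T) (descendants E C R))
    (hv : ∀ T ∈ l, Accepted E S d i T → Visits E C W S d i T)
    (hw : w + l.length * (2000 * E.candidateTime) + 50 * n ≤ W) (o : List (Set V)) :
    ∃ L : List (Set V),
      ListsExactly L {X | ∃ T ∈ l, Accepted E S d i T ∧ X ∈ descendants E C T} ∧
      Reach E (2 * W) ⟨S, d, i, 0, l :: p, o⟩ (startLag W d + w) ⟨S, d, i + 1, 1, p, o ++ L⟩
        (startLag W d + w + (l.length * (2000 * E.candidateTime) + 50 * n)) := by
  induction l generalizing w o with
  | nil =>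
    refine ⟨[], ⟨List.nodup_nil, by simp⟩, ?_⟩
    simpa using reach_close (E := E) (D := 2 * W) (S := S) (d := d) (p := p) (o := o)
      (a := startLag W d + w) hn hi
  | cons T l ih =>
    have hs : startLag W d ≤ W := by unfold startLag; split_ifs <;> omega
    have hlen : (T :: l).length * (2000 * E.candidateTime) =
        l.length * (2000 * E.candidateTime) + 2000 * E.candidateTime := by
      rw [List.length_cons]; ring
    rw [hlen] at hw ⊢
    have hl' := List.nodup_cons.1 hl
    have ih' := fun w hw => ih (w := w) hl'.2
      (fun T hT R hR => hdisj T (List.mem_cons_of_mem _ hT) R (List.mem_cons_of_mem _ hR))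
      (fun T hT => hv T (List.mem_cons_of_mem _ hT)) hw
    by_cases hT : Accepted E S d i T
    · obtain ⟨hd, hv'⟩ := hv T List.mem_cons_self hT
      obtain ⟨L₁, h1, h2⟩ := hv' (l :: p)
        (if (d + 1) % 2 = 1 then o ++ [T] else o) (by simp [hp])
      have h3 := reach_accept (E := E) (D := 2 * W) (a := startLag W d + w) (l := l) (r := p)
        (o := o) hn hT hd (by omega)
      have h4 := (h3.mono (c := startLag W (d + 1)) (by
        unfold startLag
        split_ifs <;> omega)).trans h2
      obtain ⟨L₂, h5, h6⟩ := ih' (w + 1000 * E.candidateTime) (by omega)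
        ((if (d + 1) % 2 = 1 then o ++ [T] else o) ++ L₁)
      refine ⟨(if (d + 1) % 2 = 1 then T :: L₁ else L₁) ++ L₂, h1.append h5 ?_ ?_, ?_⟩
      · rw [Set.disjoint_left]
        rintro X hX ⟨R, hR, hR', hXR⟩
        exact Set.disjoint_left.1 (hdisj T List.mem_cons_self R (List.mem_cons_of_mem _ hR) hT hR'
          (fun h => hl'.1 (h ▸ hR))) hX hXR
      · intro X
        simp [hT]
      · have ho : o ++ ((if (d + 1) % 2 = 1 then T :: L₁ else L₁) ++ L₂) =
            ((if (d + 1) % 2 = 1 then o ++ [T] else o) ++ L₁) ++ L₂ := by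
          split_ifs <;> simp
        rw [ho]
        exact (h4.trans_le h6 (by omega)).mono (by omega)
    · obtain ⟨L, h5, h6⟩ := ih' (w + 1000 * E.candidateTime) (by omega) o
      refine ⟨L, ⟨h5.1, fun X => (h5.2 X).trans (by simp [hT])⟩, ?_⟩
      exact ((reach_reject hn hT).trans_le h6 (by omega)).mono (by omega)

/-- Running through the indices of a node from the `i`-th one on. -/
theorem reach_indices (hE : E.Admissible C) {N : ℕ} (hN : ∀ Y, Y.Nonempty → (E.L₂ Y).length ≤ N)
    (hS : S ∈ C) (hd : d ≤ n) (hd0 : d ≠ 0) (p : List (List (Set V))) (hp : p.length = d)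
    (hv : ∀ T, IsChild E C T S → Visits E C W S d (key E T) T) (k : ℕ) (hk : k + i = n)
    (hw : w + k * (500 * n + E.θ₂t + N * (2000 * E.candidateTime)) ≤ W) (o : List (Set V)) :
    ∃ L : List (Set V),
      ListsExactly L {X | ∃ T, (IsChild E C T S ∧ i ≤ key E T) ∧ X ∈ descendants E C T} ∧
      Reach E (2 * W) ⟨S, d, i, 1, p, o⟩ (startLag W d + w) ⟨S, d, n, 1, p, o ++ L⟩
        (startLag W d + w + k * (500 * n + E.θ₂t + N * (2000 * E.candidateTime))) := by
  induction k generalizing w i o with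
  | zero =>
    obtain rfl : i = n := by omega
    refine ⟨[], ⟨List.nodup_nil, fun X => ?_⟩, ?_⟩
    · simp only [List.not_mem_nil, false_iff]
      rintro ⟨T, ⟨h1, h2⟩, -⟩
      exact absurd (h1.key_lt hE) (not_lt.2 h2)
    · simpa using Reach.refl
  | succ k ih =>
    have hi : i < n := by omega
    have hm : (k + 1) * (500 * n + E.θ₂t + N * (2000 * E.candidateTime)) =
        k * (500 * n + E.θ₂t + N * (2000 * E.candidateTime)) + (500 * n + E.θ₂t +
          N * (2000 * E.candidateTime)) := by ring
    rw [hm] at hw ⊢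
    -- the second oracle promises nothing for `∅`, but no child is empty either
    by_cases hne : S \ {E.v ⟨i, hi⟩} = ∅
    · obtain ⟨L, h1, h2⟩ := ih (i := i + 1) (w := w + 400 * n) (by omega) (by omega) o
      refine ⟨L, ⟨h1.1, fun X => (h1.2 X).trans ⟨?_, ?_⟩⟩,
        ((reach_skip hE.pos hi hne).trans_le h2 (by omega)).mono (by omega)⟩
      · rintro ⟨T, ⟨h3, h4⟩, h5⟩
        exact ⟨T, ⟨h3, by omega⟩, h5⟩
      · rintro ⟨T, ⟨h3, h4⟩, h5⟩
        refine ⟨T, ⟨h3, Nat.lt_of_le_of_ne h4 fun h => ?_⟩, h5⟩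
        have := ((isChild_iff hE hS hi).1 ⟨h3, h.symm⟩).1.2.1
        rw [hne] at this
        exact (hE.nonempty h3.mem h3.pos).ne_empty (Set.subset_empty_iff.1 this)
    · have hne' := Set.nonempty_iff_ne_empty.2 hne
      obtain ⟨hl, hmem⟩ := hE.second _ hne'
      have hlen : (E.L₂ (S \ {E.v ⟨i, hi⟩})).length * (2000 * E.candidateTime) ≤
        N * (2000 * E.candidateTime) := Nat.mul_le_mul_right _ (hN _ hne')
      have hacc : ∀ T, (T ∈ E.L₂ (S \ {E.v ⟨i, hi⟩}) ∧ Accepted E S d i T) ↔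
          IsChild E C T S ∧ key E T = i := by
        intro T
        rw [isChild_iff hE hS hi, hmem]
        simp [Accepted, hd0]
      obtain ⟨L₁, h1, h2⟩ := reach_scan (E := E) (C := C) (W := W) (S := S) (d := d) (i := i)
        (w := w + (400 * n + E.θ₂t)) hE.pos hi.le p hp _ hl
        (fun T hT R hR hT' hR' => ((hacc T).1 ⟨hT, hT'⟩).1.disjoint hE ((hacc R).1 ⟨hR, hR'⟩).1)
        (fun T hT hT' => by
          obtain ⟨h3, h4⟩ := (hacc T).1 ⟨hT, hT'⟩
          exact h4 ▸ hv T h3) (by omega) o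
      obtain ⟨L₂, h5, h6⟩ := ih (i := i + 1)
        (w := w + (500 * n + E.θ₂t + N * (2000 * E.candidateTime))) (by omega) (by omega) (o ++ L₁)
      refine ⟨L₁ ++ L₂, h1.append h5 ?_ ?_, ?_⟩
      · rw [Set.disjoint_left]
        rintro X ⟨T, hT, hT', hX⟩ ⟨R, ⟨hR, hR'⟩, hXR⟩
        obtain ⟨h7, h8⟩ := (hacc T).1 ⟨hT, hT'⟩
        refine Set.disjoint_left.1 (h7.disjoint hE hR ?_) hX hXR
        rintro rfl
        omega
      · intro X
        constructor
        · rintro ⟨T, ⟨hT, hT'⟩, hX⟩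
          rcases Nat.eq_or_lt_of_le hT' with h | h
          · obtain ⟨h7, h8⟩ := (hacc T).2 ⟨hT, h.symm⟩
            exact Or.inl ⟨T, h7, h8, hX⟩
          · exact Or.inr ⟨T, ⟨hT, h⟩, hX⟩
        · rintro (⟨T, hT, hT', hX⟩ | ⟨T, ⟨hT, hT'⟩, hX⟩)
          · obtain ⟨h7, h8⟩ := (hacc T).1 ⟨hT, hT'⟩
            exact ⟨T, ⟨h7, h8.ge⟩, hX⟩
          · exact ⟨T, ⟨hT, by omega⟩, hX⟩
      · rw [← List.append_assoc]
        exact (((reach_open hE.pos hi hne (by omega)).trans_le h2 (by omega)).trans_le h6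
          (by omega)).mono (by omega)

/-- Every subtree is visited completely. The depth stays below `n`, since a node at depth `d` has
at most `n + 1 - d` elements. -/
theorem visits (hE : E.Admissible C) {N : ℕ} (hN : ∀ Y, Y.Nonempty → (E.L₂ Y).length ≤ N)
    (hW : n * (500 * n + E.θ₂t + N * (2000 * E.candidateTime)) + 1000 * E.candidateTime ≤ W)
    (hT : T ∈ C) (hρ : 0 < E.ρ T) (hdT : d + T.ncard ≤ n)
    (hback : d = 0 ∧ S = Set.univ ∧ i = n ∨ d ≠ 0 ∧ parent E T = S ∧ key E T = i) :
    Visits E C W S d i T := by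
  have hfin := E.finite
  induction hc : T.ncard using Nat.strong_induction_on generalizing T S d i with
  | _ c ih =>
    have hc0 : 0 < T.ncard := (hE.nonempty hT hρ).ncard_pos
    refine ⟨by omega, fun p o hp => ?_⟩
    have hn := hE.pos
    have hQ := E.le_candidateTime
    have hs : startLag W (d + 1) ≤ W := by unfold startLag; split_ifs <;> omega
    obtain ⟨L, h1, h2⟩ := reach_indices (E := E) (C := C) (W := W) (S := T) (d := d + 1) (i := 0)
      (w := 0) hE hN hT (by omega) (by omega) p hp
      (fun R hR => by
        have := Set.ncard_lt_ncard (hR.ssubset hE)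
        exact ih _ (hc ▸ this) hR.mem hR.pos (by omega)
          (Or.inr ⟨by omega, hR.parent_eq, rfl⟩) rfl) n rfl (by omega) o
    -- `T` comes before its proper descendants at odd depth, and after them at even depth
    have hT₁ : ListsExactly [T] {T} := ⟨List.nodup_singleton T, by simp⟩
    have hdis : Disjoint {T} {X | ∃ R, (IsChild E C R T ∧ 0 ≤ key E R) ∧
        X ∈ descendants E C R} := by
      rw [Set.disjoint_singleton_left]
      rintro ⟨R, ⟨hR, -⟩, hTR⟩
      exact (hR.ssubset hE).not_subset (subset_of_mem_descendants hE hTR)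
    have hdesc : ∀ X, X ∈ descendants E C T ↔ X ∈ ({T} : Set (Set V)) ∨
        X ∈ {X | ∃ R, (IsChild E C R T ∧ 0 ≤ key E R) ∧ X ∈ descendants E C R} := by
      intro X
      rw [mem_descendants_iff]
      simp
    rcases hback with ⟨rfl, rfl, rfl⟩ | ⟨hd0, rfl, rfl⟩
    · refine ⟨L, by simpa using hT₁.append h1 hdis hdesc, ?_⟩
      exact (h2.trans (reach_leave_root hn le_rfl (by omega))).mono (by
        simp only [startLag]
        norm_num
        omega)
    · have h3 := reach_leave (E := E) (D := 2 * W) (S := T) (d := d + 1) (i := n) (p := p)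
        (o := o ++ L)
        (a := startLag W (d + 1) + 0 + n * (500 * n + E.θ₂t + N * (2000 * E.candidateTime)))
        hn le_rfl (by omega) (by omega) (by omega)
      refine ⟨if (d + 1) % 2 = 1 then L else L ++ [T], ?_, ?_⟩
      · split_ifs
        · simpa using hT₁.append h1 hdis hdesc
        · exact h1.append hT₁ hdis.symm fun X => (hdesc X).trans or_comm
      · have ho : o ++ (if (d + 1) % 2 = 1 then L else L ++ [T]) =
            if (d + 1) % 2 = 1 then o ++ L else o ++ L ++ [T] := by
          split_ifs <;> simp
        rw [ho]
        refine (h2.trans h3).mono ?_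
        unfold startLag
        split_ifs <;> omega

end Traversal

/-! ### The enumeration theorem -/

section Main

variable {V : Type u} {n : ℕ}

theorem secondOracle_length_le {E : Env V n} {C : Set (Set V)} (h : IsSecondOracle C E.L₂)
    {δ : Set V → ℕ} (hδ : Monotone δ) (hC : ∀ X, (maxComponents C X).ncard ≤ δ X) (Y : Set V)
    (hY : Y.Nonempty) : (E.L₂ Y).length ≤ δ Set.univ := by
  classical
  obtain ⟨h1, h2⟩ := h Y hY
  have h3 : maxComponents C Y = ((E.L₂ Y).toFinset : Set (Set V)) := by
    ext Z
    simp [h2]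
  have h4 := hC Y
  rw [h3, Set.ncard_coe_finset, List.toFinset_card_of_nodup h1] at h4
  exact h4.trans (hδ (Set.subset_univ Y))

theorem enumerator_spec {E : Env V n} {C : Set (Set V)} (hE : E.Admissible C) {N W : ℕ}
    (hN : ∀ Y, Y.Nonempty → (E.L₂ Y).length ≤ N) (hθ : 1 ≤ E.θ₂t)
    (hW : W = 4000 * (n * E.θ₂t + E.candidateTime * n * N)) :
    Enumerates enumerator E {X | X ∈ C ∧ 0 < E.ρ X} (2 * W)
      (8000 * ((n + E.θ₁s + E.θ₂s + E.θρs) * n)) := by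
  have hn := hE.pos
  have hfin := E.finite
  have hQ := E.le_candidateTime
  have huniv : (Set.univ : Set V).Nonempty := ⟨E.v ⟨0, hn⟩, trivial⟩
  obtain ⟨hl, hmem⟩ := hE.second _ huniv
  have hθn : n ≤ n * E.θ₂t := Nat.le_mul_of_pos_right n hθ
  have hθθ : E.θ₂t ≤ n * E.θ₂t := Nat.le_mul_of_pos_left _ hn
  have hlen : (E.L₂ Set.univ).length * (2000 * E.candidateTime) ≤
      2000 * (E.candidateTime * n * N) := by
    calc (E.L₂ Set.univ).length * (2000 * E.candidateTime)
        ≤ N * (2000 * E.candidateTime) := Nat.mul_le_mul_right _ (hN _ huniv)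
      _ = 2000 * (E.candidateTime * 1 * N) := by ring
      _ ≤ 2000 * (E.candidateTime * n * N) := by gcongr
  obtain ⟨L, h1, h2⟩ := reach_scan (E := E) (C := C) (W := W) (S := Set.univ) (d := 0) (i := n)
    (w := 200 * n + E.θ₂t) hn le_rfl [] rfl (E.L₂ Set.univ) hl
    (fun T hT R hR _ _ => disjoint_of_maximal hE ((hmem T).1 hT) ((hmem R).1 hR))
    (fun T hT hT' => by
      -- without a candidate `N` may be `0`, and then `W` would not cover the work at a node
      have hN1 : 1 ≤ N := (List.length_pos_of_mem hT).trans_le (hN _ huniv)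
      have hQ1 : E.candidateTime ≤ E.candidateTime * n * N := by
        calc E.candidateTime = E.candidateTime * 1 * 1 := by ring
          _ ≤ E.candidateTime * n * N := by gcongr
      have hn2 : n * n ≤ E.candidateTime * n * N := by
        calc n * n = n * n * 1 := by ring
          _ ≤ E.candidateTime * n * N := by gcongr
      refine visits hE hN ?_ ((hmem T).1 hT).1 hT'.1 ?_ (Or.inl ⟨rfl, rfl, rfl⟩)
      · have : n * (500 * n + E.θ₂t + N * (2000 * E.candidateTime)) =
          500 * (n * n) + n * E.θ₂t + 2000 * (E.candidateTime * n * N) := by ring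
        omega
      · have : T.ncard ≤ Nat.card V := Set.ncard_le_card T
        rwa [Nat.card_congr E.v.symm, Nat.card_fin, ← zero_add T.ncard] at this)
    (by omega) []
  obtain ⟨st, h3, h4⟩ := run_prepare E (2 * W) hn
  obtain ⟨s₁, h5, h6⟩ := h4 _ (describes_init E (2 * W))
  have hstart : startLag W 0 = W := rfl
  obtain ⟨s₂, h7, h8⟩ := h2 s₁ ⟨st, h3, h6.mono (by omega)⟩
  obtain ⟨s, st', h9, h10, h11⟩ := searchLoop_end (by omega) h7
  have ho : s.outs.map Prod.snd = L := by
    rw [h10.outs, h11, List.nil_append]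
  refine ⟨s, .seq _ _ _ _ _ h5 (h8 _ h9), ho ▸ h1.1, fun X => ?_, ?_, ?_⟩
  · rw [ho, h1.2]
    refine Iff.trans ?_ (exists_mem_descendants_iff (T := X) hE)
    simp [Accepted, hmem]
  · rw [List.isChain_append]
    refine ⟨h10.chain, by simp, fun t ht t' ht' => ?_⟩
    have := h10.time t ht
    simp at ht'
    omega
  · have h12 := h10.top
    have h13 := h10.aux
    have h14 : (n + E.θ₁s + E.θ₂s + E.θρs) * n =
      n * n + n * E.θ₁s + n * E.θ₂s + n * E.θρs := by ring
    have h15 : (n + 1) * (E.θ₂s + 1) = n * E.θ₂s + n + E.θ₂s + 1 := by ring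
    have h16 := Nat.le_mul_of_pos_left n hn
    have h17 := Nat.le_mul_of_pos_left E.θ₁s hn
    have h18 := Nat.le_mul_of_pos_left E.θ₂s hn
    have h19 := Nat.le_mul_of_pos_left E.θρs hn
    omega

/-- The item `k` distinguishes sets that differ in `v_k`, so that every component is a solution. -/
theorem isSolution_coItems_iff (v : Fin n ≃ V) (C : Set (Set V)) (X : Set V) :
    IsSolution C (Set.Icc 1 n) (coItems v) X ↔ X ∈ C := by
  refine ⟨fun h => h.1, fun h => ⟨h, fun Y _ hXY => ?_⟩⟩
  obtain ⟨y, hy, hyX⟩ := Set.exists_of_ssubset hXY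
  have hsub : commonItems (Set.Icc 1 n) (coItems v) Y ⊆ commonItems (Set.Icc 1 n) (coItems v) X :=
    fun k hk => ⟨hk.1, fun x hx => hk.2 x (hXY.subset hx)⟩
  refine (Set.ssubset_iff_of_subset hsub).2
    ⟨(v.symm y : ℕ) + 1, ⟨?_, fun x hx => ⟨?_, ?_⟩⟩, fun h => (h.2 y hy).2 rfl⟩
  · exact ⟨by omega, (v.symm y).2⟩
  · exact ⟨by omega, (v.symm y).2⟩
  · intro h
    have : v.symm y = v.symm x := Fin.ext (Nat.succ_injective h)
    exact hyX (v.symm.injective this ▸ hx)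

end Main

theorem corollary1 :
    (∀ (V : Type u) (n : ℕ) (v : Fin n ≃ V) (C : Set (Set V)), 1 ≤ n → IsTransitive C →
      {X | IsSolution C (Set.Icc 1 n) (coItems v) X} = C) ∧
    ∃ (P : Cmd) (c : ℕ), ∀ (V : Type u) (n : ℕ) (E : Env V n) (C : Set (Set V)) (δ : Set V → ℕ),
      1 ≤ n → IsTransitive C →
      IsFirstOracle C E.L₁ → IsSecondOracle C E.L₂ → 1 ≤ E.θ₂t →
      Monotone E.ρ → (∅ ∈ C → E.ρ ∅ ≤ 0) →
      Monotone δ → (∀ X, (maxComponents C X).ncard ≤ δ X) →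
      Enumerates P E {X | X ∈ C ∧ 0 < E.ρ X}
        (c * (n * E.θ₂t + (n ^ 2 + n * E.θ₁t + E.θρt) * n * δ Set.univ))
        (c * ((n + E.θ₁s + E.θ₂s + E.θρs) * n)) := by
  refine ⟨fun V n v C _ _ => Set.ext fun X => isSolution_coItems_iff v C X,
    enumerator, 8000, fun V n E C δ hn _ h₁ h₂ hθ hρ hempty hδ hC => ?_⟩
  have h := enumerator_spec (E := E) ⟨hn, h₁, h₂, hρ, hempty⟩
    (secondOracle_length_le h₂ hδ hC) hθ rfl
  rwa [← mul_assoc] at h
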